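/- Let $\beta>0$, let $p\ge1$ be the integer with $p-1<\beta\le p$ (so $p-1=\lfloor\beta\rfloor$, the greatest integer strictly less than $\beta$), let $L>0$, $r>0$, $x\in(0,1)$, and let $\Sigma(\beta,L)$ be the class of functions $f$ on $[0,1]$ that are $p-1$ times differentiable with $|f^{(p-1)}(s)-f^{(p-1)}(t)|\le L|s-t|^{\beta-p+1}$. **Model and estimator.** For each $n$ one observes $Y_i=f(X_i)+\sigma_{0,i}\varepsilon_i$, $i=1,\dots,n$, with deterministic $X_i\in[0,1]$ and independent standard normal $\varepsilon_i$; $\mathbb E$ is the expectation in this model. The working model is $Y\sim N(\Psi^\top\theta,\Sigma)$, where $\Sigma=\mathrm{diag}(\sigma_1^2,\dots,\sigma_n^2)$ and $\Psi$ is the $p\times n$ matrix with columns $\Psi_i=(1,X_i-x,\dots,(X_i-x)^{p-1}/(p-1)!)^\top$. Given scales $k=1,\dots,K$ with bandwidths $\frac1{2n}\le h_1<\dots<h_K\le1$ and weights $w_{k,i}\in[0,1]$, put $\mathcal W_k=\mathrm{diag}(w_{k,i}/\sigma_i^2)$, $B_k=\Psi\mathcal W_k\Psi^\top$, $\tilde\theta_k=B_k^{-1}\Psi\mathcal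 W_kY$, $\theta^*_k=\mathbb E\tilde\theta_k$, $T_{lm}=(\tilde\theta_l-\tilde\theta_m)^\top B_l(\tilde\theta_l-\tilde\theta_m)$. For critical values $\mathfrak z_1,\dots,\mathfrak z_{K-1}$ let $$\hat k=\max\{k\le K: T_{lm}\le\mathfrak z_l\text{ for all } l<m\le k\},\qquad \hat\theta_k=\tilde\theta_{\min(k,\hat k)},\qquad \hat f(x)=e_1^\top\tilde\theta_{\hat k}.$$ All quantities $K,X_i,h_k,w_{k,i},\sigma_i,\sigma_{0,i},\mathfrak z_k$ may depend on $n$. **Assumptions.** Let $0<\sigma_{\min}^2\le\sigma_{\max}^2$, $\lambda_0,a_0>0$, $w_{\max}$, $1<u_0\le u$, $\alpha\in(0,1]$, $\mu\in(0,1/4)$, $s_1,C_w,c_H>0$ be constants independent of $n$, and $\delta_n\in[0,1)$ with $\delta_n=o(1/\log n)$. For all sufficiently large $n$: * (S) $1-\delta_n\le\sigma_{0,i}^2/\sigma_i^2\le1+\delta_n$; (S1) $\sigma_{\min}^2\le\sigma_i^2\le\sigma_{\max}^2$; * (B) $u_0B_{k-1}\preceq B_k\preceq uB_{k-1}$ for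 $2\le k\le K$; (D) $\Psi$ has rank $p$; (Loc) at least $p$ indices $i$ have $w_{1,i}>0$; (W) $w_{l,i}\le w_{m,i}$, and moreover $w_{l,i}w_{m,i}=w_{l,i}$, for $l\le m$; * (Lp1') the smallest eigenvalue of $H_k^{-1}B_kH_k^{-1}$ is at least $nh_k\lambda_0/\sigma_{\max}^2$ for all $k$, where $H_k=\mathrm{diag}(1,h_k,\dots,h_k^{p-1})$; (Lp2') $\frac1n\#\{i:X_i\in A\}\le a_0\max\{|A|,\frac1n\}$ for every interval $A\subseteq[0,1]$; (Lp3') $w_{k,i}=0$ if $|X_i-x|>h_k$; (Lp4') $|w_{k,i}|\le w_{\max}$; * (PC) $\mathbb E_{0,\Sigma}|(\tilde\theta_k-\hat\theta_k)^\top B_k(\tilde\theta_k-\hat\theta_k)|^r\le\alpha\, C(p,r)$ for $2\le k\le K$, where $\mathbb E_{0,\Sigma}$ is the expectation under $Y\sim N(0,\Sigma)$ and $C(p,r)=2^r\Gamma(r+p/2)/\Gamma(p/2)$; and the critical values do not exceed the theoretical ones: $$\mathfrak z_k\le\tfrac4\mu\Big\{r(K-k)\log u+\log\tfrac K\alpha-\tfrac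 p4\log(1-4\mu)-\log(1-u^{-r})+\log\tfrac{2^{2r}[\Gamma(2r+p/2)\Gamma(p/2)]^{1/2}}{\Gamma(r+p/2)}\Big\},\quad 1\le k<K;$$ * the largest bandwidth satisfies $h_K\ge c_H n^{-1/(2\beta+1)}$. For a function $f$ put $\bar b_{k,f}=\max_{l\le k}|e_1^\top\theta^*_l-f(x)|$, $\sigma_k^2=\mathrm{Var}(e_1^\top\tilde\theta_k)$ (true model) and $k^\star=\max\{k\le K:\bar b_{k,f}\le C_w\sigma_k\}$, and let $\mathcal F_n$ be the set of $f\in\Sigma(\beta,L)$ such that * the first scale is accepted, i.e. $\bar b_{1,f}\le C_w\sigma_1$ (so that $k^\star$ exists); * (S$k^\star$1) $\mathbf\Sigma_{k^\star,1}^{-1}\preceq s_1\mathbf\Sigma_{k^\star,1,\mathrm{diag}}^{-1}$, where $\mathbf\Sigma_{k,1}$ is the covariance matrix of $(e_1^\top\tilde\theta_1,\dots,e_1^\top\tilde\theta_k)$ in the working model and $\mathbf\Sigma_{k,1,\mathrm{diag}}$ is its diagonal part. **Conclusion.** With $\gamma=\frac{2\beta+1}{2\beta}$, for all sufficiently large $n$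 and all $f\in\mathcal F_n$, $$\mathbb E|f(x)-\hat f(x)|^r\le C\,L^{\frac r{2\beta+1}}\Big(\frac{\log^\gamma n}{n}\Big)^{\frac{r\beta}{2\beta+1}}(1+o(1)),\qquad n\to\infty,$$ where $C$ depends only on $r,\beta,p,\sigma_{\min}^2,\sigma_{\max}^2,w_{\max},\lambda_0,a_0$, and the $o(1)$ term does not depend on $f$. -/

import Mathlib

open MeasureTheory ProbabilityTheory Filter Topology Asymptotics
open scoped NNReal ENNReal Nat Matrix

noncomputable section

namespace LocPoly

/-- The Hölder class `Σ(β, L)` on `[0,1]`: `f` is `ℓ` times differentiable on `[0,1]` and its `ℓ`-th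
derivative is Hölder continuous with exponent `β - ℓ` and constant `L`, where `ℓ` is the greatest
integer strictly less than `β`. -/
def HolderClass (ℓ : ℕ) (β L : ℝ) : Set (ℝ → ℝ) :=
  {f | (∀ j < ℓ, DifferentiableOn ℝ (iteratedDerivWithin j f (Set.Icc 0 1)) (Set.Icc 0 1)) ∧
    ∀ s ∈ Set.Icc (0 : ℝ) 1, ∀ t ∈ Set.Icc (0 : ℝ) 1,
      |iteratedDerivWithin ℓ f (Set.Icc 0 1) s - iteratedDerivWithin ℓ f (Set.Icc 0 1) t|
        ≤ L * |s - t| ^ (β - ℓ)}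

/-- `C(p, r) = E|χ²_p|^r`. -/
def chiSqMoment (p : ℕ) (r : ℝ) : ℝ :=
  2 ^ r * Real.Gamma (r + p / 2) / Real.Gamma (p / 2)

/-- The theoretical critical values
`(4/μ) {r (K - k) log u + log (K/α) - (p/4) log (1 - 4μ) - log (1 - u^{-r}) + C̄(p,r)}`. -/
def theoreticalCrit (p : ℕ) (r α μ u : ℝ) (K k : ℕ) : ℝ :=
  4 / μ * (r * ((K : ℝ) - k) * Real.log u + Real.log (K / α) - p / 4 * Real.log (1 - 4 * μ)
    - Real.log (1 - u ^ (-r))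
    + Real.log (2 ^ (2 * r) * Real.sqrt (Real.Gamma (2 * r + p / 2) * Real.Gamma (p / 2))
        / Real.Gamma (r + p / 2)))

/-- Everything that is fixed for sample size `n` and reference point `x`, except for the regression
function. Scales are numbered `1, …, K`; critical values are `z 1, …, z (K - 1)`. -/
structure Scheme (n : ℕ) where
  /-- number of scales -/
  K : ℕ
  /-- design points -/
  X : Fin n → ℝ
  /-- bandwidths `h_k` -/
  h : ℕ → ℝ
  /-- localizing weights `w_{k,i}(x)` -/
  w : ℕ → Fin n → ℝ
  /-- variances `σ_i²` of the approximate model (known to the statistician) -/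
  varModel : Fin n → ℝ≥0
  /-- true variances `σ_{0,i}²` -/
  varTrue : Fin n → ℝ≥0
  /-- critical values -/
  z : ℕ → ℝ

namespace Scheme

variable {n : ℕ} (S : Scheme n) (ℓ : ℕ) (x : ℝ)

/-! ### Local polynomial (quasi maximum likelihood) estimators of order `ℓ = p - 1` -/

/-- The `p × n` design matrix with columns `(1, X_i - x, …, (X_i - x)^{p-1}/(p-1)!)`. -/
def Psi : Matrix (Fin (ℓ + 1)) (Fin n) ℝ :=
  Matrix.of fun j i => (S.X i - x) ^ (j : ℕ) / ((j : ℕ)! : ℝ)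

/-- `W_k = diag(w_{k,i} / σ_i²)`. -/
def W (k : ℕ) : Matrix (Fin n) (Fin n) ℝ :=
  Matrix.diagonal fun i => S.w k i / (S.varModel i : ℝ)

/-- `B_k = Ψ W_k Ψᵀ`. -/
def B (k : ℕ) : Matrix (Fin (ℓ + 1)) (Fin (ℓ + 1)) ℝ :=
  S.Psi ℓ x * S.W k * (S.Psi ℓ x)ᵀ

/-- The local polynomial estimator `θ̃_k = B_k⁻¹ Ψ W_k Y`. -/
def qmle (k : ℕ) (y : Fin n → ℝ) : Fin (ℓ + 1) → ℝ :=
  (S.B ℓ x k)⁻¹ *ᵥ ((S.Psi ℓ x * S.W k) *ᵥ y)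

/-- The local quasi log-likelihood `L(W_k, θ)`, up to a term that does not depend on `θ`. -/
def logLik (k : ℕ) (θ : Fin (ℓ + 1) → ℝ) (y : Fin n → ℝ) : ℝ :=
  -(1 / 2) * ∑ i, (y i - ((S.Psi ℓ x)ᵀ *ᵥ θ) i) ^ 2 * (S.w k i / (S.varModel i : ℝ))

/-- The fitted log-likelihood statistic `T_{lm} = 2 L(W_l, θ̃_l, θ̃_m)`. -/
def T (l m : ℕ) (y : Fin n → ℝ) : ℝ :=
  2 * (S.logLik ℓ x l (S.qmle ℓ x l y) y - S.logLik ℓ x l (S.qmle ℓ x m y) y)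

/-- Lepski's selection rule `k̂ = max {k ≤ K : T_{lm} ≤ z_l for all l < m ≤ k}`. -/
def khat (y : Fin n → ℝ) : ℕ :=
  sSup {k | 1 ≤ k ∧ k ≤ S.K ∧ ∀ l m, 1 ≤ l → l < m → m ≤ k → S.T ℓ x l m y ≤ S.z l}

/-- The last accepted estimator after `k` steps, `θ̂_k = θ̃_{min(k, k̂)}`. -/
def lastAccepted (k : ℕ) (y : Fin n → ℝ) : Fin (ℓ + 1) → ℝ :=
  S.qmle ℓ x (min k (S.khat ℓ x y)) y

/-- The adaptive local polynomial estimator `f̂(x) = e₁ᵀ θ̃_{k̂}`. -/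
def fhat (y : Fin n → ℝ) : ℝ :=
  S.qmle ℓ x (S.khat ℓ x y) y 0

/-! ### Distributions of the observations -/

/-- The law of `Y_i = f(X_i) + σ_{0,i} ε_i` with independent standard normal `ε_i`. -/
def trueLaw (f : ℝ → ℝ) : Measure (Fin n → ℝ) :=
  Measure.pi fun i => gaussianReal (f (S.X i)) (S.varTrue i)

/-- The centred law `N(0, Σ)` of the approximate model. -/
def nullLaw : Measure (Fin n → ℝ) :=
  Measure.pi fun i => gaussianReal 0 (S.varModel i)

/-! ### Bias, variance and the oracle index -/

/-- `b_{k,f}(x) = e₁ᵀ θ*_k - f(x)` with `θ*_k = B_k⁻¹ Ψ W_k (f(X_1), …, f(X_n))ᵀ`. -/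
def bias (f : ℝ → ℝ) (k : ℕ) : ℝ :=
  S.qmle ℓ x k (fun i => f (S.X i)) 0 - f x

/-- `sup_{1 ≤ l ≤ k} |b_{l,f}(x)|`. -/
def supBias (f : ℝ → ℝ) (k : ℕ) : ℝ :=
  ⨆ l : Set.Icc 1 k, |S.bias ℓ x f l|

/-- `σ_k(x)`, the standard deviation of `e₁ᵀ θ̃_k` under the true law. -/
def stdDev (f : ℝ → ℝ) (k : ℕ) : ℝ :=
  Real.sqrt (variance (fun y => S.qmle ℓ x k y 0) (S.trueLaw f))

/-- The index `k⋆` of the ideal bandwidth: the largest `k ≤ K` for which the bias does not exceed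
`Cw` times the standard deviation. -/
def oracleIndex (f : ℝ → ℝ) (Cw : ℝ) : ℕ :=
  sSup {k | 1 ≤ k ∧ k ≤ S.K ∧ S.supBias ℓ x f k ≤ Cw * S.stdDev ℓ x f k}

/-- The covariance matrix of `e₁ᵀ θ̃_1, …, e₁ᵀ θ̃_k` in the approximate model. (It does not depend on
the mean, which is therefore taken to be zero.) -/
def covFirst (k : ℕ) : Matrix (Fin k) (Fin k) ℝ :=
  Matrix.of fun l m =>
    covariance (fun y => S.qmle ℓ x ((l : ℕ) + 1) y 0)
      (fun y => S.qmle ℓ x ((m : ℕ) + 1) y 0) S.nullLaw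

/-! ### The conditions; `A ≼ B` for symmetric matrices is written `(B - A).PosSemidef` -/

/-- Design points in `[0,1]`, weights in `[0,1]`, increasing bandwidths
`1/(2n) ≤ h_1 < … < h_K ≤ 1`. -/
def CondBasic : Prop :=
  1 ≤ S.K ∧ (∀ i, S.X i ∈ Set.Icc (0 : ℝ) 1) ∧
    (∀ k ∈ Finset.Icc 1 S.K, ∀ i, S.w k i ∈ Set.Icc (0 : ℝ) 1) ∧
    1 / (2 * (n : ℝ)) ≤ S.h 1 ∧ S.h S.K ≤ 1 ∧ StrictMonoOn S.h (Set.Icc 1 S.K)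

/-- `(B)`. As `B_{k-1}` is positive definite, `u₀ I ≼ B_{k-1}^{-1/2} B_k B_{k-1}^{-1/2} ≼ u I` is
the same as `u₀ B_{k-1} ≼ B_k ≼ u B_{k-1}`. -/
def CondB (u₀ u : ℝ) : Prop :=
  ∀ k, 2 ≤ k → k ≤ S.K →
    (S.B ℓ x k - u₀ • S.B ℓ x (k - 1)).PosSemidef ∧
    (u • S.B ℓ x (k - 1) - S.B ℓ x k).PosSemidef

/-- `(D)`: the design matrix has full row rank. -/
def CondD : Prop := (S.Psi ℓ x).rank = ℓ + 1

/-- `(Loc)`: at least `p` design points carry a positive weight on the smallest scale. -/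
def CondLoc : Prop := ℓ + 1 ≤ {i | 0 < S.w 1 i}.ncard

/-- The propagation conditions `(PC)`. -/
def CondPC (r α : ℝ) : Prop :=
  ∀ k, 2 ≤ k → k ≤ S.K →
    ∫⁻ y, ENNReal.ofReal
        (|(S.qmle ℓ x k y - S.lastAccepted ℓ x k y) ⬝ᵥ
            (S.B ℓ x k *ᵥ (S.qmle ℓ x k y - S.lastAccepted ℓ x k y))| ^ r) ∂S.nullLaw
      ≤ ENNReal.ofReal (α * chiSqMoment (ℓ + 1) r)

/-- The critical values do not exceed the theoretical ones. -/
def CondCrit (r α μ u : ℝ) : Prop :=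
  ∀ k, 1 ≤ k → k < S.K → S.z k ≤ theoreticalCrit (ℓ + 1) r α μ u S.K k

/-- `(S)`: relative misspecification of the variances. -/
def CondS (δ : ℝ) : Prop :=
  ∀ i, 1 - δ ≤ (S.varTrue i : ℝ) / S.varModel i ∧ (S.varTrue i : ℝ) / S.varModel i ≤ 1 + δ

/-- `(S1)`, with `vmin = σ_min²` and `vmax = σ_max²`. -/
def CondS1 (vmin vmax : ℝ) : Prop :=
  ∀ i, vmin ≤ (S.varModel i : ℝ) ∧ (S.varModel i : ℝ) ≤ vmax

/-- `(Lp1')`, in the scale-invariant form: with `H_k = diag(1, h_k, …, h_k^{p-1})` the smallest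
eigenvalue of `H_k⁻¹ B_k H_k⁻¹` is at least `n h_k λ₀ / σ_max²`. As `0 < h_k ≤ 1`, it follows from
the same bound for the smallest eigenvalue of `B_k` itself, and agrees with it for `p = 1`. -/
def CondLp1 (lam₀ vmax : ℝ) : Prop :=
  ∀ k ∈ Finset.Icc 1 S.K,
    (S.B ℓ x k - (n * S.h k * lam₀ / vmax) •
      Matrix.diagonal fun j : Fin (ℓ + 1) => (S.h k ^ (j : ℕ)) ^ 2).PosSemidef

/-- `(Lp2')`; closed intervals suffice, since an interval and its closure have the same length. -/
def CondLp2 (a₀ : ℝ) : Prop :=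
  ∀ a b : ℝ, 0 ≤ a → a ≤ b → b ≤ 1 →
    1 / (n : ℝ) * {i | S.X i ∈ Set.Icc a b}.ncard ≤ a₀ * max (b - a) (1 / (n : ℝ))

/-- `(Lp3')`. -/
def CondLp3 : Prop :=
  ∀ k ∈ Finset.Icc 1 S.K, ∀ i, S.h k < |S.X i - x| → S.w k i = 0

/-- `(Lp4')`. -/
def CondLp4 (wmax : ℝ) : Prop :=
  ∀ k ∈ Finset.Icc 1 S.K, ∀ i, |S.w k i| ≤ wmax

/-- The ordering condition `(W)`. -/
def CondW : Prop :=
  ∀ l m, 1 ≤ l → l ≤ m → m ≤ S.K → ∀ i, S.w l i ≤ S.w m i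

/-- `w_{l,i} w_{m,i} = w_{l,i}` for `l ≤ m`. -/
def CondProd : Prop :=
  ∀ l m, 1 ≤ l → l ≤ m → m ≤ S.K → ∀ i, S.w l i * S.w m i = S.w l i

/-- The first estimator is accepted: scale `1` meets the relation that defines the oracle index. -/
def FirstAccepted (f : ℝ → ℝ) (Cw : ℝ) : Prop :=
  S.supBias ℓ x f 1 ≤ Cw * S.stdDev ℓ x f 1

/-- `(Skj)` for a scale `k` and `j = 1`: `Σ_{k,1}⁻¹ ≼ s Σ_{k,1,diag}⁻¹`. -/
def CondSk1 (s : ℝ) (k : ℕ) : Prop :=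
  (s • (Matrix.diagonal (S.covFirst ℓ x k).diag)⁻¹ - (S.covFirst ℓ x k)⁻¹).PosSemidef

end Scheme

end LocPoly

end

/-!
Take as reference scale the last one at which the squared bias `L² h^(2β)` is at most a large
multiple `M` of the variance `1 / (n h)`, or scale `1` if there is none; its bias is then
controlled by the acceptance of the first scale. The estimators up to that scale depend on the
data only through `ℓ + 1` linear statistics per scale. There are `O(log n)` scales, `δ n = o(1 /
log n)`, and the squared norm of the residual mean is `O(M)` in the metric of the working model,
so the likelihood ratio of these statistics under the true law to pure noise has a bounded second
moment. By `∫ρG ≤ ∫G² + ∫ρ²`, the propagation condition carries over from pure noise to the true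
law and controls the distance between the estimator at the reference scale and the last accepted
one up to that scale. If a larger scale is selected, it has passed the test against the reference
scale, so its distance to the reference estimator is at most the critical value, which is `O(log
n)`. Finally, either the next scale violates the balance, so that by `(B)` the variance at the
reference scale is `M^(-1/(2β+1))` times the squared Hölder rate up to constants, or the reference
scale is the largest one; then its bandwidth bounds the variance and no critical value enters, so
there is no logarithmic loss. Since `M` is arbitrary, every positive leading constant can be
reached.
-/

namespace LocPoly

section GaussianProducts

variable {ι κ : Type*} [Fintype ι] (m : ι → ℝ) (s : ι → ℝ≥0)

lemma hasLaw_eval_pi_gaussianReal (i : ι) :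
    HasLaw (fun y : ι → ℝ => y i) (gaussianReal (m i) (s i))
      (Measure.pi fun i => gaussianReal (m i) (s i)) :=
  (measurePreserving_eval (fun i => gaussianReal (m i) (s i)) i).hasLaw

lemma memLp_two_eval_pi_gaussianReal (i : ι) :
    MemLp (fun y : ι → ℝ => y i) 2 (Measure.pi fun i => gaussianReal (m i) (s i)) :=
  (hasLaw_eval_pi_gaussianReal m s i).hasGaussianLaw.memLp_two

lemma iIndepFun_eval_pi_gaussianReal :
    iIndepFun (fun i (y : ι → ℝ) => y i) (Measure.pi fun i => gaussianReal (m i) (s i)) :=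
  iIndepFun_pi (X := fun _ => id) fun _ => aemeasurable_id

lemma covariance_eval_pi_gaussianReal [DecidableEq ι] (i i' : ι) :
    cov[fun y : ι → ℝ => y i, fun y => y i'; Measure.pi fun i => gaussianReal (m i) (s i)]
      = if i = i' then (s i : ℝ) else 0 := by
  split_ifs with h
  · rw [← h, covariance_self (measurable_pi_apply i).aemeasurable,
      (hasLaw_eval_pi_gaussianReal m s i).variance_eq]
    exact variance_id_gaussianReal
  · exact ((iIndepFun_eval_pi_gaussianReal m s).indepFun h).covariance_eq_zero
      (memLp_two_eval_pi_gaussianReal m s i) (memLp_two_eval_pi_gaussianReal m s i')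

lemma covariance_sum_mul_pi_gaussianReal (a b : ι → ℝ) :
    cov[fun y => ∑ i, a i * y i, fun y => ∑ i, b i * y i;
        Measure.pi fun i => gaussianReal (m i) (s i)] = ∑ i, a i * b i * s i := by
  classical
  rw [covariance_fun_sum_fun_sum (fun i => (memLp_two_eval_pi_gaussianReal m s i).const_mul (a i))
    fun i => (memLp_two_eval_pi_gaussianReal m s i).const_mul (b i)]
  simp only [covariance_const_mul_left, covariance_const_mul_right,
    covariance_eval_pi_gaussianReal, mul_ite, mul_zero, Finset.sum_ite_eq, Finset.mem_univ, if_true]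
  exact Finset.sum_congr rfl fun _ _ => by ring

lemma integral_sum_mul_pi_gaussianReal (a : ι → ℝ) :
    ∫ y, ∑ i, a i * y i ∂(Measure.pi fun i => gaussianReal (m i) (s i)) = ∑ i, a i * m i := by
  rw [integral_finsetSum _ fun i _ =>
    ((memLp_two_eval_pi_gaussianReal m s i).integrable one_le_two).const_mul (a i)]
  simp only [integral_const_mul, (hasLaw_eval_pi_gaussianReal m s _).integral_eq,
    integral_id_gaussianReal]

lemma hasGaussianLaw_sum_mul_pi_gaussianReal [Finite κ] (a : κ → ι → ℝ) :
    HasGaussianLaw (fun y j => ∑ i, a j i * y i)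
      (Measure.pi fun i => gaussianReal (m i) (s i)) := by
  classical
  have := Fintype.ofFinite κ
  have hcoord : HasGaussianLaw (fun (y : ι → ℝ) i => y i)
      (Measure.pi fun i => gaussianReal (m i) (s i)) :=
    (iIndepFun_eval_pi_gaussianReal m s).hasGaussianLaw fun i =>
      (hasLaw_eval_pi_gaussianReal m s i).hasGaussianLaw
  exact hcoord.map_fun (Matrix.toLin' (Matrix.of a)).toContinuousLinearMap

lemma hasLaw_sum_mul_pi_gaussianReal (a : ι → ℝ) :
    HasLaw (fun y => ∑ i, a i * y i)
      (gaussianReal (∑ i, a i * m i) (∑ i, a i ^ 2 * s i).toNNReal)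
      (Measure.pi fun i => gaussianReal (m i) (s i)) := by
  have hmeas : AEMeasurable (fun y => ∑ i, a i * y i)
      (Measure.pi fun i => gaussianReal (m i) (s i)) :=
    (by fun_prop : Measurable _).aemeasurable
  refine ⟨hmeas, ?_⟩
  rw [((hasGaussianLaw_sum_mul_pi_gaussianReal m s fun _ : Unit => a).eval ()).map_eq_gaussianReal,
    integral_sum_mul_pi_gaussianReal, ← covariance_self hmeas, covariance_sum_mul_pi_gaussianReal]
  simp only [sq]

lemma hasLaw_pi_gaussianReal_of_orthogonal [Fintype κ] (a : κ → ι → ℝ)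
    (h : Pairwise fun j j' => ∑ i, a j i * a j' i * s i = 0) :
    HasLaw (fun y j => ∑ i, a j i * y i)
      (Measure.pi fun j => gaussianReal (∑ i, a j i * m i) (∑ i, a j i ^ 2 * s i).toNNReal)
      (Measure.pi fun i => gaussianReal (m i) (s i)) :=
  ((hasGaussianLaw_sum_mul_pi_gaussianReal m s a).iIndepFun_of_covariance_eq_zero fun _ _ hj =>
    (covariance_sum_mul_pi_gaussianReal m s _ _).trans (h hj)).hasLaw_pi fun j =>
      hasLaw_sum_mul_pi_gaussianReal m s (a j)

lemma hasLaw_add_pi_gaussianReal (c : ι → ℝ) :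
    HasLaw (fun y => y + c) (Measure.pi fun i => gaussianReal (m i + c i) (s i))
      (Measure.pi fun i => gaussianReal (m i) (s i)) :=
  (measurePreserving_pi _ _ fun i =>
    ⟨by fun_prop, gaussianReal_map_add_const (c i)⟩).hasLaw

end GaussianProducts

section ChangeOfMeasure

lemma lintegral_withDensity_le_sq_add_sq {Ω : Type*} [MeasurableSpace Ω] {μ : Measure Ω}
    {ρ G : Ω → ℝ≥0∞} (hρ : Measurable ρ) (hG : Measurable G) :
    ∫⁻ x, G x ∂μ.withDensity ρ ≤ ∫⁻ x, G x ^ 2 ∂μ + ∫⁻ x, ρ x ^ 2 ∂μ := by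
  rw [lintegral_withDensity_eq_lintegral_mul _ hρ hG, ← lintegral_add_left (hG.pow_const 2)]
  refine lintegral_mono fun x => ?_
  rw [Pi.mul_apply]
  rcases le_total (ρ x) (G x) with hle | hle
  · calc ρ x * G x ≤ G x ^ 2 := by rw [sq]; gcongr
      _ ≤ _ := le_self_add
  · calc ρ x * G x ≤ ρ x ^ 2 := by rw [sq]; gcongr
      _ ≤ _ := le_add_self

section Pi

variable {κ : Type*} [Fintype κ] {α : κ → Type*} [∀ j, MeasurableSpace (α j)]
  (μ : ∀ j, Measure (α j)) [∀ j, IsProbabilityMeasure (μ j)]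

lemma lintegral_pi_prod {ρ : ∀ j, α j → ℝ≥0∞} (hρ : ∀ j, Measurable (ρ j)) :
    ∫⁻ x, ∏ j, ρ j (x j) ∂Measure.pi μ = ∏ j, ∫⁻ x, ρ j x ∂μ j := by
  rw [lintegral_prod_eq_prod_lintegral_of_indepFun Finset.univ _
    (iIndepFun_pi fun j => (hρ j).aemeasurable) fun j => (hρ j).comp (measurable_pi_apply j)]
  exact Finset.prod_congr rfl fun j _ => (measurePreserving_eval μ j).lintegral_comp (hρ j)

lemma pi_withDensity_prod {ρ : ∀ j, α j → ℝ≥0∞} (hρ : ∀ j, Measurable (ρ j))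
    [∀ j, SigmaFinite ((μ j).withDensity (ρ j))] :
    (Measure.pi μ).withDensity (fun x => ∏ j, ρ j (x j))
      = Measure.pi fun j => (μ j).withDensity (ρ j) := by
  refine (Measure.pi_eq fun A hA => ?_).symm
  have hindicator (x : ∀ j, α j) : (Set.univ.pi A).indicator (fun x => ∏ j, ρ j (x j)) x
      = ∏ j, (A j).indicator (ρ j) (x j) := by
    by_cases hx : x ∈ Set.univ.pi A
    · rw [Set.indicator_of_mem hx]
      exact Finset.prod_congr rfl fun j _ => (Set.indicator_of_mem (hx j trivial) _).symm
    · obtain ⟨j, hj⟩ : ∃ j, x j ∉ A j := by simpa only [Set.mem_univ_pi, not_forall] using hx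
      rw [Set.indicator_of_notMem hx]
      exact (Finset.prod_eq_zero (Finset.mem_univ j) (Set.indicator_of_notMem hj _)).symm
  rw [withDensity_apply _ (.univ_pi hA), ← lintegral_indicator (.univ_pi hA)]
  simp_rw [hindicator, lintegral_pi_prod μ fun j => (hρ j).indicator (hA j),
    lintegral_indicator (hA _), withDensity_apply _ (hA _)]

end Pi

/-- The likelihood ratio of `N(m, s)` with respect to the standard normal law. -/
noncomputable def gaussianRatio (m : ℝ) (s : ℝ≥0) (x : ℝ) : ℝ≥0∞ :=
  gaussianPDF m s x / gaussianPDF 0 1 x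

lemma measurable_gaussianRatio (m : ℝ) (s : ℝ≥0) : Measurable (gaussianRatio m s) :=
  (measurable_gaussianPDF _ _).div (measurable_gaussianPDF _ _)

lemma withDensity_gaussianRatio (m : ℝ) {s : ℝ≥0} (hs : s ≠ 0) :
    (gaussianReal 0 1).withDensity (gaussianRatio m s) = gaussianReal m s := by
  rw [gaussianReal_of_var_ne_zero _ one_ne_zero, gaussianReal_of_var_ne_zero _ hs,
    ← withDensity_mul _ (measurable_gaussianPDF _ _) (measurable_gaussianRatio m s)]
  congr 1
  ext x
  exact ENNReal.mul_div_cancel (gaussianPDF_pos 0 one_ne_zero x).ne' gaussianPDF_ne_top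

lemma gaussianPDFReal_sq_div (m : ℝ) {s : ℝ≥0} (hs : s ≠ 0) (hs2 : (s : ℝ) < 2) (x : ℝ) :
    gaussianPDFReal m s x ^ 2 / gaussianPDFReal 0 1 x
      = Real.exp (m ^ 2 / (2 - s)) / √(s * (2 - s))
        * gaussianPDFReal (2 * m / (2 - s)) (s / (2 - s) : ℝ).toNNReal x := by
  have hs0 : (0 : ℝ) < s := by positivity
  have h2s : (0 : ℝ) < 2 - s := by linarith
  have hsqrt : 0 < √(s : ℝ) ∧ 0 < √(2 - s : ℝ) ∧ 0 < √(2 * Real.pi) :=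
    ⟨by positivity, by positivity, by positivity⟩
  have hexp : Real.exp (-(x - m) ^ 2 / (2 * s)) ^ 2 = Real.exp (m ^ 2 / (2 - s)) *
      Real.exp (-(x - 2 * m / (2 - s)) ^ 2 / (2 * (s / (2 - s)))) *
      Real.exp (-(x - 0) ^ 2 / (2 * (1 : ℝ≥0))) := by
    rw [← Real.exp_nat_mul, ← Real.exp_add, ← Real.exp_add]
    congr 1
    push_cast
    field_simp
    ring
  rw [div_eq_iff (gaussianPDFReal_pos 0 1 x one_ne_zero).ne']
  simp only [gaussianPDFReal]
  rw [Real.coe_toNNReal _ (by positivity), mul_pow, hexp,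
    Real.sqrt_mul (by positivity) (s : ℝ), Real.sqrt_mul (by positivity) (s / (2 - s) : ℝ),
    Real.sqrt_div' _ h2s.le, Real.sqrt_mul hs0.le]
  field_simp [hsqrt]
  simp

lemma lintegral_gaussianRatio_sq (m : ℝ) {s : ℝ≥0} (hs : s ≠ 0) (hs2 : (s : ℝ) < 2) :
    ∫⁻ x, gaussianRatio m s x ^ 2 ∂gaussianReal 0 1
      = ENNReal.ofReal (Real.exp (m ^ 2 / (2 - s)) / √(s * (2 - s))) := by
  have hvar : (s / (2 - s) : ℝ).toNNReal ≠ 0 := by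
    have : (0 : ℝ) < s := by positivity
    simpa using div_pos this (sub_pos.2 hs2)
  have hdensity (x : ℝ) : gaussianPDF 0 1 x * gaussianRatio m s x ^ 2
      = ENNReal.ofReal (Real.exp (m ^ 2 / (2 - s)) / √(s * (2 - s)))
        * gaussianPDF (2 * m / (2 - s)) (s / (2 - s) : ℝ).toNNReal x := by
    have hpos := gaussianPDFReal_pos 0 1 x one_ne_zero
    have hnonneg := gaussianPDFReal_nonneg m s x
    simp only [gaussianRatio, gaussianPDF]
    rw [← ENNReal.ofReal_div_of_pos hpos, ← ENNReal.ofReal_pow (by positivity),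
      ← ENNReal.ofReal_mul hpos.le, ← ENNReal.ofReal_mul (by positivity),
      ← gaussianPDFReal_sq_div m hs hs2]
    congr 1
    field_simp
  rw [gaussianReal_of_var_ne_zero _ one_ne_zero, lintegral_withDensity_eq_lintegral_mul _
    (measurable_gaussianPDF _ _) ((measurable_gaussianRatio m s).pow_const 2)]
  simp_rw [Pi.mul_apply, hdensity]
  rw [lintegral_const_mul _ (measurable_gaussianPDF _ _), lintegral_gaussianPDF_eq_one _ hvar,
    mul_one]

lemma lintegral_pi_gaussianReal_le {κ : Type*} [Fintype κ] (m : κ → ℝ) {s : κ → ℝ≥0}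
    (hs : ∀ j, s j ≠ 0) (hs2 : ∀ j, (s j : ℝ) < 2) {G : (κ → ℝ) → ℝ≥0∞} (hG : Measurable G) :
    ∫⁻ x, G x ∂(Measure.pi fun j => gaussianReal (m j) (s j))
      ≤ ∫⁻ x, G x ^ 2 ∂(Measure.pi fun _ : κ => gaussianReal 0 1)
        + ENNReal.ofReal (∏ j, Real.exp (m j ^ 2 / (2 - s j)) / √(s j * (2 - s j))) := by
  have hmeas (j : κ) : Measurable (gaussianRatio (m j) (s j)) := measurable_gaussianRatio _ _
  have hwd (j : κ) := withDensity_gaussianRatio (m j) (hs j)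
  have (j : κ) : SigmaFinite ((gaussianReal 0 1).withDensity (gaussianRatio (m j) (s j))) := by
    rw [hwd]; infer_instance
  have hpi := pi_withDensity_prod (fun _ : κ => gaussianReal 0 1) hmeas
  simp_rw [hwd] at hpi
  rw [← hpi]
  have hprod : Measurable fun x : κ → ℝ => ∏ j, gaussianRatio (m j) (s j) (x j) :=
    Finset.measurable_prod _ fun j _ => (hmeas j).comp (measurable_pi_apply j)
  refine (lintegral_withDensity_le_sq_add_sq hprod hG).trans ?_
  simp_rw [← Finset.prod_pow]
  rw [lintegral_pi_prod _ fun j => (hmeas j).pow_const 2,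
    ENNReal.ofReal_prod_of_nonneg fun _ _ => by positivity]
  simp_rw [lintegral_gaussianRatio_sq _ (hs _) (hs2 _)]
  rfl

end ChangeOfMeasure

section Diagonalization

lemma exists_orthonormalBasis_diagonal {E : Type*} [NormedAddCommGroup E] [InnerProductSpace ℝ E]
    [FiniteDimensional ℝ E] (V : Submodule ℝ E) {D : E →ₗ[ℝ] E} (hD : D.IsSymmetric) :
    ∃ b : OrthonormalBasis (Fin (Module.finrank ℝ V)) ℝ V,
      Pairwise fun j j' => inner ℝ (D (b j : E)) (b j' : E) = 0 := by
  let T : V →ₗ[ℝ] V := V.orthogonalProjectionOnto.toLinearMap ∘ₗ D ∘ₗ V.subtype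
  have inner_T (v w : V) : inner ℝ (T v) w = inner ℝ (D (v : E)) (w : E) := by simp [T]
  have hT : T.IsSymmetric := fun v w => by
    rw [inner_T, real_inner_comm (T w), inner_T, real_inner_comm, hD]
  refine ⟨hT.eigenvectorBasis rfl, fun j j' hj => ?_⟩
  change inner ℝ (D _) _ = 0
  rw [← inner_T, hT.apply_eigenvectorBasis, inner_smul_left,
    (hT.eigenvectorBasis rfl).inner_eq_zero hj, mul_zero]

variable {ι κ : Type*} [Fintype ι] [Fintype κ]

/-- `a` is orthonormal for the inner product with diagonal weights `s`. -/
def IsWeightedOrthonormal [DecidableEq κ] (s : ι → ℝ) (a : κ → ι → ℝ) : Prop :=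
  ∀ j j', ∑ i, a j i * a j' i * s i = if j = j' then 1 else 0

lemma exists_orthonormal_diagonal (v : κ → ι → ℝ) (d : ι → ℝ) :
    ∃ N ≤ Fintype.card κ, ∃ b : Fin N → ι → ℝ, (∀ c, v c ∈ Submodule.span ℝ (Set.range b)) ∧
      IsWeightedOrthonormal 1 b ∧ Pairwise fun j j' => ∑ i, b j i * b j' i * d i = 0 := by
  classical
  have inner_eq (z z' : EuclideanSpace ℝ ι) : inner ℝ z z' = ∑ i, z i * z' i := by
    simp [PiLp.inner_apply, mul_comm]
  let vt : κ → EuclideanSpace ℝ ι := fun c => WithLp.toLp 2 (v c)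
  obtain ⟨b, hb⟩ := exists_orthonormalBasis_diagonal (Submodule.span ℝ (Set.range vt))
    (Matrix.isSymmetric_toEuclideanLin_iff.2 (Matrix.isHermitian_diagonal d))
  refine ⟨Module.finrank ℝ (Submodule.span ℝ (Set.range vt)), finrank_range_le_card vt,
    fun j => (b j : EuclideanSpace ℝ ι), fun c => ?_, fun j j' => ?_, fun j j' hj => ?_⟩
  · let vc : Submodule.span ℝ (Set.range vt) := ⟨vt c, Submodule.subset_span ⟨c, rfl⟩⟩
    have hsum := congrArg Subtype.val (b.sum_repr vc)
    refine (Submodule.mem_span_range_iff_exists_fun ℝ).2 ⟨b.repr vc, funext fun i => ?_⟩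
    simpa [vt, vc] using congrArg (fun z : EuclideanSpace ℝ ι => z i) hsum
  · rw [← orthonormal_iff_ite.1 b.orthonormal j j', Submodule.coe_inner, inner_eq]
    simp only [Pi.one_apply, mul_one]
  · rw [← hb hj, inner_eq]
    refine Finset.sum_congr rfl fun i _ => ?_
    simp only [Matrix.toLpLin_apply, Matrix.mulVec_diagonal]
    ring

lemma exists_weightedOrthonormal_diagonal (v : κ → ι → ℝ) {s : ι → ℝ} (hs : ∀ i, 0 < s i)
    (s₀ : ι → ℝ) :
    ∃ N ≤ Fintype.card κ, ∃ a : Fin N → ι → ℝ, (∀ c, v c ∈ Submodule.span ℝ (Set.range a)) ∧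
      IsWeightedOrthonormal s a ∧ Pairwise fun j j' => ∑ i, a j i * a j' i * s₀ i = 0 := by
  have hq (i : ι) : √(s i) ≠ 0 := (Real.sqrt_pos.2 (hs i)).ne'
  have hqq (i : ι) : √(s i) ^ 2 = s i := Real.sq_sqrt (hs i).le
  obtain ⟨N, hN, b, hspan, hort, hdiag⟩ :=
    exists_orthonormal_diagonal (fun c i => v c i * √(s i)) fun i => s₀ i / s i
  refine ⟨N, hN, fun j i => b j i / √(s i), fun c => ?_, fun j j' => ?_, fun j j' hj => ?_⟩
  · obtain ⟨d, hd⟩ := (Submodule.mem_span_range_iff_exists_fun ℝ).1 (hspan c)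
    refine (Submodule.mem_span_range_iff_exists_fun ℝ).2 ⟨d, funext fun i => ?_⟩
    have hd_i := congrArg (· / √(s i)) (congrFun hd i)
    simpa [Finset.sum_div, mul_div_assoc, hq i] using hd_i
  · rw [← hort j j']
    refine Finset.sum_congr rfl fun i _ => ?_
    rw [← hqq, Pi.one_apply]
    field [hq i]
  · rw [← hdiag hj]
    refine Finset.sum_congr rfl fun i _ => ?_
    rw [← hqq]
    field [hq i]

section Weighted

variable [DecidableEq κ] {s : ι → ℝ} {a : κ → ι → ℝ}

lemma IsWeightedOrthonormal.sum_mul_sum (h : IsWeightedOrthonormal s a) (ξ : κ → ℝ) (j : κ) :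
    ∑ i, a j i * ∑ j', ξ j' * (a j' i * s i) = ξ j := by
  calc ∑ i, a j i * ∑ j', ξ j' * (a j' i * s i)
      = ∑ j', ξ j' * ∑ i, a j i * a j' i * s i := by
        simp only [Finset.mul_sum]
        rw [Finset.sum_comm]
        exact Finset.sum_congr rfl fun _ _ => Finset.sum_congr rfl fun _ _ => by ring
    _ = ξ j := by simp [h j _]

lemma IsWeightedOrthonormal.sum_sq_le (h : IsWeightedOrthonormal s a) (hs : ∀ i, 0 < s i)
    (g : ι → ℝ) : ∑ j, (∑ i, a j i * g i) ^ 2 ≤ ∑ i, g i ^ 2 / s i := by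
  set ξ : κ → ℝ := fun j => ∑ i, a j i * g i
  set p : ι → ℝ := fun i => ∑ j, ξ j * (a j i * s i) with hp
  have hswap (z : ι → ℝ) : ∑ i, z i * p i / s i = ∑ j, ξ j * ∑ i, a j i * z i := by
    simp only [hp, Finset.mul_sum, Finset.sum_div]
    rw [Finset.sum_comm]
    refine Finset.sum_congr rfl fun j _ => Finset.sum_congr rfl fun i _ => ?_
    have := (hs i).ne'
    field_simp
  have hgp : ∑ i, g i * p i / s i = ∑ j, ξ j ^ 2 := by simp only [hswap, sq, ξ]
  have hpp : ∑ i, p i * p i / s i = ∑ j, ξ j ^ 2 := by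
    rw [hswap]
    simp only [hp, h.sum_mul_sum, sq]
  have hnonneg : 0 ≤ ∑ i, (g i - p i) ^ 2 / s i :=
    Finset.sum_nonneg fun i _ => div_nonneg (sq_nonneg _) (hs i).le
  have hexpand : ∑ i, (g i - p i) ^ 2 / s i
      = ∑ i, g i ^ 2 / s i - 2 * ∑ i, g i * p i / s i + ∑ i, p i * p i / s i := by
    rw [Finset.mul_sum, ← Finset.sum_sub_distrib, ← Finset.sum_add_distrib]
    exact Finset.sum_congr rfl fun i _ => by ring
  linarith

lemma IsWeightedOrthonormal.eq_comp_of_mem_span {v : ι → ℝ}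
    (h : IsWeightedOrthonormal s a) (hv : v ∈ Submodule.span ℝ (Set.range a)) (y : ι → ℝ) :
    ∑ i, v i * ∑ j, (∑ i', a j i' * y i') * (a j i * s i) = ∑ i, v i * y i := by
  obtain ⟨d, rfl⟩ := (Submodule.mem_span_range_iff_exists_fun ℝ).1 hv
  have hswap (z : ι → ℝ) : ∑ i, (∑ j, d j • a j) i * z i = ∑ j, d j * ∑ i, a j i * z i := by
    simp only [Finset.sum_apply, Pi.smul_apply, smul_eq_mul, Finset.sum_mul, Finset.mul_sum]
    rw [Finset.sum_comm]
    exact Finset.sum_congr rfl fun _ _ => Finset.sum_congr rfl fun _ _ => by ring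
  rw [hswap, hswap]
  simp only [h.sum_mul_sum]

end Weighted

end Diagonalization

section Comparison

lemma prod_exp_div_sqrt_le {κ : Type*} [Fintype κ] {m t : κ → ℝ} {δ A : ℝ} {N : ℕ} (hδ0 : 0 ≤ δ)
    (hδ1 : δ < 1) (ht : ∀ j, t j ∈ Set.Icc (1 - δ) (1 + δ)) (hA : ∑ j, m j ^ 2 ≤ A)
    (hN : Fintype.card κ ≤ N) :
    ∏ j, Real.exp (m j ^ 2 / (2 - t j)) / √(t j * (2 - t j))
      ≤ Real.exp (A / (1 - δ)) * (1 / √(1 - δ ^ 2)) ^ N := by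
  have hδ : 0 < 1 - δ := sub_pos.2 hδ1
  have hsqrt : 0 < √(1 - δ ^ 2) := Real.sqrt_pos.2 (by nlinarith)
  calc ∏ j, Real.exp (m j ^ 2 / (2 - t j)) / √(t j * (2 - t j))
      ≤ ∏ j, Real.exp (m j ^ 2 / (1 - δ)) * (1 / √(1 - δ ^ 2)) := by
        refine Finset.prod_le_prod (fun j _ => by positivity) fun j _ => ?_
        have hexp : m j ^ 2 / (2 - t j) ≤ m j ^ 2 / (1 - δ) :=
          div_le_div_of_nonneg_left (sq_nonneg _) hδ (by linarith [(ht j).2])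
        have hden : 1 - δ ^ 2 ≤ t j * (2 - t j) := by nlinarith [(ht j).1, (ht j).2]
        rw [div_eq_mul_one_div]
        gcongr
    _ = Real.exp ((∑ j, m j ^ 2) / (1 - δ)) * (1 / √(1 - δ ^ 2)) ^ Fintype.card κ := by
        rw [Finset.prod_mul_distrib, ← Real.exp_sum, Finset.sum_div, Finset.prod_const,
          Finset.card_univ]
    _ ≤ Real.exp (A / (1 - δ)) * (1 / √(1 - δ ^ 2)) ^ N := by
        have hone_le : 1 ≤ 1 / √(1 - δ ^ 2) :=
          (one_le_div hsqrt).2 (Real.sqrt_le_one.2 (by linarith [sq_nonneg δ]))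
        gcongr

variable {ι κ : Type*} [Fintype ι]

lemma IsWeightedOrthonormal.sum_sq_mul_mem_Icc [DecidableEq κ] {s s₀ : ι → ℝ} {a : κ → ι → ℝ}
    (h : IsWeightedOrthonormal s a) {δ : ℝ} (hlo : ∀ i, (1 - δ) * s i ≤ s₀ i)
    (hhi : ∀ i, s₀ i ≤ (1 + δ) * s i) (j : κ) :
    ∑ i, a j i ^ 2 * s₀ i ∈ Set.Icc (1 - δ) (1 + δ) := by
  have hone : ∑ i, a j i ^ 2 * s i = 1 := by simpa [sq] using h j j
  have hscale (c : ℝ) : c = ∑ i, a j i ^ 2 * (c * s i) := by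
    simp_rw [mul_left_comm _ c, ← Finset.mul_sum, hone, mul_one]
  constructor
  · rw [hscale (1 - δ)]
    gcongr with i
    exact hlo i
  · rw [hscale (1 + δ)]
    gcongr with i
    exact hhi i

/-- Only the finitely many linear statistics `∑ i, v c i * y i` enter, so the price of changing
the measure is governed by their number rather than by the sample size. -/
lemma lintegral_pi_gaussianReal_le_of_linear [Fintype κ] (v : κ → ι → ℝ) (g : ι → ℝ)
    {s s₀ : ι → ℝ≥0} {δ : ℝ} (hδ0 : 0 ≤ δ) (hδ1 : δ < 1) (hs : ∀ i, 0 < s i)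
    (hlo : ∀ i, (1 - δ) * s i ≤ s₀ i)
    (hhi : ∀ i, (s₀ i : ℝ) ≤ (1 + δ) * s i) {G : (ι → ℝ) → ℝ≥0∞} (hG : Measurable G)
    (hGv : ∀ y y', (∀ c, ∑ i, v c i * y i = ∑ i, v c i * y' i) → G y = G y') :
    ∫⁻ y, G y ∂(Measure.pi fun i => gaussianReal (g i) (s₀ i))
      ≤ ∫⁻ y, G y ^ 2 ∂(Measure.pi fun i => gaussianReal 0 (s i))
        + ENNReal.ofReal (Real.exp ((∑ i, g i ^ 2 / s i) / (1 - δ))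
            * (1 / √(1 - δ ^ 2)) ^ Fintype.card κ) := by
  obtain ⟨N, hN, a, hspan, horth, hdiag⟩ :=
    exists_weightedOrthonormal_diagonal v (s := fun i => s i) hs fun i => s₀ i
  let score (y : ι → ℝ) (j : Fin N) : ℝ := ∑ i, a j i * y i
  let recon (ξ : Fin N → ℝ) (i : ι) : ℝ := ∑ j, ξ j * (a j i * s i)
  have hG_score (y : ι → ℝ) : G y = G (recon (score y)) :=
    hGv _ _ fun c => (horth.eq_comp_of_mem_span (hspan c) y).symm
  have hG_recon : Measurable fun ξ => G (recon ξ) := hG.comp (by fun_prop)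
  have hvar := horth.sum_sq_mul_mem_Icc hlo hhi
  have hvar_pos (j : Fin N) : 0 < ∑ i, a j i ^ 2 * s₀ i := by linarith [(hvar j).1]
  have htrue : HasLaw score _ (Measure.pi fun i => gaussianReal (g i) (s₀ i)) :=
    hasLaw_pi_gaussianReal_of_orthogonal g s₀ a hdiag
  have hnull : HasLaw score (Measure.pi fun _ => gaussianReal 0 1)
      (Measure.pi fun i => gaussianReal 0 (s i)) := by
    have hlaw := hasLaw_pi_gaussianReal_of_orthogonal (fun _ => 0) s a
      fun j j' hj => by simpa [hj] using horth j j'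
    have hvar_one (j : Fin N) : ∑ i, a j i ^ 2 * (s i : ℝ) = 1 := by simpa [sq] using horth j j
    simpa [hvar_one] using hlaw
  calc ∫⁻ y, G y ∂(Measure.pi fun i => gaussianReal (g i) (s₀ i))
      = ∫⁻ y, G (recon (score y)) ∂(Measure.pi fun i => gaussianReal (g i) (s₀ i)) :=
        lintegral_congr hG_score
    _ = ∫⁻ ξ, G (recon ξ) ∂(Measure.pi fun j =>
          gaussianReal (∑ i, a j i * g i) (∑ i, a j i ^ 2 * s₀ i).toNNReal) :=
        htrue.lintegral_comp hG_recon.aemeasurable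
    _ ≤ ∫⁻ ξ, G (recon ξ) ^ 2 ∂(Measure.pi fun _ => gaussianReal 0 1) + ENNReal.ofReal (∏ j, _) :=
        lintegral_pi_gaussianReal_le _ (fun j => (Real.toNNReal_pos.2 (hvar_pos j)).ne')
          (fun j => by
            rw [Real.coe_toNNReal _ (hvar_pos j).le]
            linarith [(hvar j).2]) hG_recon
    _ ≤ _ := ?_
  rw [← hnull.lintegral_comp (hG_recon.pow_const 2).aemeasurable]
  simp_rw [← hG_score, Real.coe_toNNReal _ (hvar_pos _).le]
  gcongr
  exact prod_exp_div_sqrt_le hδ0 hδ1 hvar (horth.sum_sq_le hs g) ((Fintype.card_fin N).trans_le hN)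

end Comparison

lemma inv_apply_self_le {p : Type*} [Fintype p] [DecidableEq p] {A : Matrix p p ℝ}
    (hA : IsUnit A.det) {c : ℝ} (hc : 0 < c) {j : p}
    (h : ∀ d : p → ℝ, c * d j ^ 2 ≤ d ⬝ᵥ (A *ᵥ d)) : A⁻¹ j j ≤ 1 / c := by
  have hcol := h (A⁻¹ *ᵥ Pi.single j 1)
  rw [Matrix.mulVec_mulVec, Matrix.mul_nonsing_inv _ hA, Matrix.one_mulVec, dotProduct_single_one,
    Matrix.mulVec_single_one, Matrix.col_apply] at hcol
  rw [le_div_iff₀ hc]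
  by_contra! hlt
  nlinarith

namespace Scheme

variable {n : ℕ} (S : Scheme n) (ℓ : ℕ) (x : ℝ)

section LocalPolynomialAlgebra

lemma qmle_eq_mulVec (k : ℕ) (y : Fin n → ℝ) :
    S.qmle ℓ x k y = ((S.B ℓ x k)⁻¹ * (S.Psi ℓ x * S.W k)) *ᵥ y :=
  Matrix.mulVec_mulVec ..

lemma Psi_mul_W_apply (k : ℕ) (c : Fin (ℓ + 1)) (i : Fin n) :
    (S.Psi ℓ x * S.W k) c i = S.Psi ℓ x c i * (S.w k i / S.varModel i) :=
  Matrix.mul_diagonal ..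

lemma dotProduct_Psi_mul_W_mulVec (k : ℕ) (d : Fin (ℓ + 1) → ℝ) (y : Fin n → ℝ) :
    d ⬝ᵥ ((S.Psi ℓ x * S.W k) *ᵥ y)
      = ∑ i, ((S.Psi ℓ x)ᵀ *ᵥ d) i * y i * (S.w k i / S.varModel i) := by
  rw [← Matrix.mulVec_mulVec, Matrix.dotProduct_mulVec, ← Matrix.mulVec_transpose, dotProduct]
  refine Finset.sum_congr rfl fun i _ => ?_
  rw [W, Matrix.mulVec_diagonal]
  ring

lemma B_mulVec (k : ℕ) (d : Fin (ℓ + 1) → ℝ) :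
    S.B ℓ x k *ᵥ d = (S.Psi ℓ x * S.W k) *ᵥ ((S.Psi ℓ x)ᵀ *ᵥ d) :=
  (Matrix.mulVec_mulVec ..).symm

/-- The weights of the observations in the first coordinate of the estimator at scale `k`, the
effective kernel of the local polynomial smoother. -/
noncomputable def smoother (k : ℕ) : Fin n → ℝ :=
  ((S.B ℓ x k)⁻¹ * (S.Psi ℓ x * S.W k)) 0

lemma qmle_apply_zero (k : ℕ) (y : Fin n → ℝ) :
    S.qmle ℓ x k y 0 = ∑ i, S.smoother ℓ x k i * y i := by
  rw [qmle_eq_mulVec]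
  rfl

variable {S ℓ x} {k : ℕ}

lemma B_mulVec_qmle (hk : IsUnit (S.B ℓ x k).det) (y : Fin n → ℝ) :
    S.B ℓ x k *ᵥ S.qmle ℓ x k y = (S.Psi ℓ x * S.W k) *ᵥ y := by
  rw [qmle, Matrix.mulVec_mulVec, Matrix.mul_nonsing_inv _ hk, Matrix.one_mulVec]

lemma T_eq_dotProduct {l : ℕ} (hl : IsUnit (S.B ℓ x l).det) (m : ℕ) (y : Fin n → ℝ) :
    S.T ℓ x l m y = (S.qmle ℓ x l y - S.qmle ℓ x m y) ⬝ᵥ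
      (S.B ℓ x l *ᵥ (S.qmle ℓ x l y - S.qmle ℓ x m y)) := by
  have normal_eq := congrArg ((S.qmle ℓ x l y - S.qmle ℓ x m y) ⬝ᵥ ·) (B_mulVec_qmle hl y)
  simp only [B_mulVec, dotProduct_Psi_mul_W_mulVec] at normal_eq
  rw [T, logLik, logLik, B_mulVec, dotProduct_Psi_mul_W_mulVec]
  generalize S.qmle ℓ x l y = a at normal_eq ⊢
  generalize S.qmle ℓ x m y = b at normal_eq ⊢
  have hexpand : ∑ i, (y i - ((S.Psi ℓ x)ᵀ *ᵥ b) i) ^ 2 * (S.w l i / S.varModel i)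
      = ∑ i, (y i - ((S.Psi ℓ x)ᵀ *ᵥ a) i) ^ 2 * (S.w l i / S.varModel i)
        + 2 * (∑ i, ((S.Psi ℓ x)ᵀ *ᵥ (a - b)) i * y i * (S.w l i / S.varModel i)
          - ∑ i, ((S.Psi ℓ x)ᵀ *ᵥ (a - b)) i * ((S.Psi ℓ x)ᵀ *ᵥ a) i
              * (S.w l i / S.varModel i))
        + ∑ i, ((S.Psi ℓ x)ᵀ *ᵥ (a - b)) i * ((S.Psi ℓ x)ᵀ *ᵥ (a - b)) i
            * (S.w l i / S.varModel i) := by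
    rw [← Finset.sum_sub_distrib, Finset.mul_sum, ← Finset.sum_add_distrib,
      ← Finset.sum_add_distrib]
    refine Finset.sum_congr rfl fun i _ => ?_
    simp only [Matrix.mulVec_sub, Pi.sub_apply]
    ring
  linarith

lemma qmle_eq_qmle_add (hk : IsUnit (S.B ℓ x k).det) {y y' : Fin n → ℝ} {θ : Fin (ℓ + 1) → ℝ}
    (h : ∀ i, S.w k i ≠ 0 → y i = y' i + ((S.Psi ℓ x)ᵀ *ᵥ θ) i) :
    S.qmle ℓ x k y = S.qmle ℓ x k y' + θ := by
  have hweighted : S.W k *ᵥ y = S.W k *ᵥ (y' + (S.Psi ℓ x)ᵀ *ᵥ θ) := by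
    ext i
    simp only [W, Matrix.mulVec_diagonal]
    obtain hi | hi := eq_or_ne (S.w k i) 0
    · simp [hi]
    · rw [h i hi, Pi.add_apply]
  have hscore : (S.Psi ℓ x * S.W k) *ᵥ y = (S.Psi ℓ x * S.W k) *ᵥ y' + S.B ℓ x k *ᵥ θ := by
    rw [← Matrix.mulVec_mulVec, hweighted, Matrix.mulVec_mulVec, Matrix.mulVec_add, ← B_mulVec]
  rw [qmle, hscore, Matrix.mulVec_add, Matrix.mulVec_mulVec θ, Matrix.nonsing_inv_mul _ hk,
    Matrix.one_mulVec, qmle]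

lemma sum_smoother_sq_mul_varModel (hk : IsUnit (S.B ℓ x k).det)
    (hw : ∀ i, S.w k i * S.w k i = S.w k i) (hv : ∀ i, 0 < S.varModel i) :
    ∑ i, S.smoother ℓ x k i ^ 2 * S.varModel i = (S.B ℓ x k)⁻¹ 0 0 := by
  have hWW : S.W k * Matrix.diagonal (fun i => (S.varModel i : ℝ)) * (S.W k)ᵀ = S.W k := by
    rw [W, Matrix.diagonal_transpose, Matrix.diagonal_mul_diagonal, Matrix.diagonal_mul_diagonal]
    congr 1
    ext i
    have : (S.varModel i : ℝ) ≠ 0 := NNReal.coe_ne_zero.2 (hv i).ne'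
    nth_rewrite 3 [← hw i]
    field_simp
  calc ∑ i, S.smoother ℓ x k i ^ 2 * S.varModel i
      = (((S.B ℓ x k)⁻¹ * (S.Psi ℓ x * S.W k)) * Matrix.diagonal (fun i => (S.varModel i : ℝ))
          * ((S.B ℓ x k)⁻¹ * (S.Psi ℓ x * S.W k))ᵀ) 0 0 := by
        rw [Matrix.mul_apply]
        refine Finset.sum_congr rfl fun i _ => ?_
        rw [Matrix.mul_diagonal, Matrix.transpose_apply, smoother]
        ring
    _ = ((S.B ℓ x k)⁻¹ * S.B ℓ x k * (S.B ℓ x k)⁻¹ᵀ) 0 0 := by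
        have hB : S.Psi ℓ x * (S.W k * Matrix.diagonal (fun i => (S.varModel i : ℝ)) * (S.W k)ᵀ)
            * (S.Psi ℓ x)ᵀ = S.B ℓ x k := by rw [hWW, B]
        rw [← congrArg ((S.B ℓ x k)⁻¹ * · * (S.B ℓ x k)⁻¹ᵀ) hB]
        simp only [Matrix.transpose_mul, Matrix.mul_assoc]
    _ = (S.B ℓ x k)⁻¹ 0 0 := by
        rw [Matrix.nonsing_inv_mul _ hk, Matrix.one_mul, Matrix.transpose_apply]

end LocalPolynomialAlgebra

section Selection

variable {S ℓ x} {k : ℕ}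

lemma khat_mem (hK : 1 ≤ S.K) (y : Fin n → ℝ) :
    1 ≤ S.khat ℓ x y ∧ S.khat ℓ x y ≤ S.K ∧
      ∀ l m, 1 ≤ l → l < m → m ≤ S.khat ℓ x y → S.T ℓ x l m y ≤ S.z l :=
  Nat.sSup_mem (s := {k | 1 ≤ k ∧ k ≤ S.K ∧
      ∀ l m, 1 ≤ l → l < m → m ≤ k → S.T ℓ x l m y ≤ S.z l})
    ⟨1, le_rfl, hK, fun _ _ _ _ _ => by omega⟩ ⟨S.K, fun _ hk => hk.2.1⟩

lemma le_khat_iff (hK : 1 ≤ S.K) (y : Fin n → ℝ) {j : ℕ} (hjK : j ≤ S.K) :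
    j ≤ S.khat ℓ x y ↔ ∀ l m, 1 ≤ l → l < m → m ≤ j → S.T ℓ x l m y ≤ S.z l := by
  refine ⟨fun h l m hl hlm hm => (khat_mem hK y).2.2 l m hl hlm (hm.trans h), fun h => ?_⟩
  obtain rfl | hj := j.eq_zero_or_pos
  · exact Nat.zero_le _
  · exact le_csSup ⟨S.K, fun _ hk => hk.2.1⟩ ⟨hj, hjK, h⟩

lemma min_khat_congr (hK : 1 ≤ S.K) (hkK : k ≤ S.K) {y y' : Fin n → ℝ}
    (h : ∀ l m, 1 ≤ l → l < m → m ≤ k → S.T ℓ x l m y = S.T ℓ x l m y') :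
    min k (S.khat ℓ x y) = min k (S.khat ℓ x y') := by
  refine eq_of_forall_le_iff fun j => ?_
  rw [le_min_iff, le_min_iff]
  refine and_congr_right fun hj => ?_
  rw [le_khat_iff hK y (hj.trans hkK), le_khat_iff hK y' (hj.trans hkK)]
  exact forall₂_congr fun l m => forall₃_congr fun hl hlm hm => by rw [h l m hl hlm (hm.trans hj)]

lemma qmle_sub_lastAccepted_congr (hK : 1 ≤ S.K) (hk : k ∈ Finset.Icc 1 S.K)
    (hdet : ∀ l ∈ Finset.Icc 1 k, IsUnit (S.B ℓ x l).det) {y y' : Fin n → ℝ}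
    {θ : Fin (ℓ + 1) → ℝ} (h : ∀ l ∈ Finset.Icc 1 k, S.qmle ℓ x l y = S.qmle ℓ x l y' + θ) :
    S.qmle ℓ x k y - S.lastAccepted ℓ x k y = S.qmle ℓ x k y' - S.lastAccepted ℓ x k y' := by
  obtain ⟨hk1, hkK⟩ := Finset.mem_Icc.1 hk
  have hmin : min k (S.khat ℓ x y) = min k (S.khat ℓ x y') :=
    min_khat_congr hK hkK fun l m hl hlm hm => by
      have hl' : l ∈ Finset.Icc 1 k := Finset.mem_Icc.2 ⟨hl, hlm.le.trans hm⟩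
      have hm' : m ∈ Finset.Icc 1 k := Finset.mem_Icc.2 ⟨hl.trans hlm.le, hm⟩
      rw [T_eq_dotProduct (hdet l hl'), T_eq_dotProduct (hdet l hl'), h l hl', h m hm',
        add_sub_add_right_eq_sub]
  have hlast : min k (S.khat ℓ x y') ∈ Finset.Icc 1 k :=
    Finset.mem_Icc.2 ⟨le_min hk1 (khat_mem hK y').1, min_le_left _ _⟩
  rw [lastAccepted, lastAccepted, hmin, h k (Finset.right_mem_Icc.2 hk1), h _ hlast,
    add_sub_add_right_eq_sub]

end Selection

section Measurability

@[fun_prop]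
lemma measurable_qmle (k : ℕ) : Measurable (S.qmle ℓ x k) :=
  (continuous_const.matrix_mulVec (continuous_const.matrix_mulVec continuous_id)).measurable

lemma measurable_logLik_qmle (k m : ℕ) :
    Measurable fun y => S.logLik ℓ x k (S.qmle ℓ x m y) y := by
  have hfit : Measurable fun y => (S.Psi ℓ x)ᵀ *ᵥ S.qmle ℓ x m y :=
    (continuous_const.matrix_mulVec continuous_id).measurable.comp (S.measurable_qmle ℓ x m)
  unfold logLik
  fun_prop

lemma measurable_T (l m : ℕ) : Measurable (S.T ℓ x l m) :=
  ((S.measurable_logLik_qmle ℓ x l l).sub (S.measurable_logLik_qmle ℓ x l m)).const_mul 2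

variable {S}

lemma measurable_khat (hK : 1 ≤ S.K) : Measurable (S.khat ℓ x) := by
  refine measurable_of_Ici fun j => ?_
  obtain hj | hj := le_or_gt j S.K
  · have hpre : S.khat ℓ x ⁻¹' Set.Ici j = ⋂ l, ⋂ m, ⋂ (_ : 1 ≤ l), ⋂ (_ : l < m), ⋂ (_ : m ≤ j),
        {y | S.T ℓ x l m y ≤ S.z l} := by
      ext y
      simp only [Set.mem_preimage, Set.mem_Ici, Set.mem_iInter, Set.mem_ofPred_eq,
        le_khat_iff hK y hj]
    rw [hpre]
    exact .iInter fun l => .iInter fun m => .iInter fun _ => .iInter fun _ => .iInter fun _ =>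
      measurableSet_le (S.measurable_T ℓ x l m) measurable_const
  · have hpre : S.khat ℓ x ⁻¹' Set.Ici j = ∅ :=
      Set.eq_empty_of_forall_notMem fun y hy => hj.not_ge (le_trans hy (khat_mem hK y).2.1)
    rw [hpre]
    exact .empty

lemma measurable_lastAccepted (hK : 1 ≤ S.K) (k : ℕ) : Measurable (S.lastAccepted ℓ x k) := by
  have hjoint : Measurable fun q : ℕ × (Fin n → ℝ) => S.qmle ℓ x (min k q.1) q.2 :=
    measurable_from_prod_countable_right fun j => S.measurable_qmle ℓ x (min k j)
  have hpair : Measurable fun y => (S.khat ℓ x y, y) :=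
    (measurable_khat ℓ x hK).prodMk measurable_id
  unfold lastAccepted
  simpa only [Function.comp_def] using hjoint.comp hpair

end Measurability

end Scheme

section Taylor

lemma norm_sub_taylorWithinEval_le_of_holder {E : Type*} [NormedAddCommGroup E] [NormedSpace ℝ E]
    {s : Set ℝ} (hs : Convex ℝ s) {x : ℝ} (hx : x ∈ s) {L γ : ℝ} (hL : 0 ≤ L) (hγ : 0 ≤ γ) {ℓ : ℕ}
    {f : ℝ → E} (hf : ∀ j < ℓ, DifferentiableOn ℝ (iteratedDerivWithin j f s) s)
    (hhol : ∀ t ∈ s, ‖iteratedDerivWithin ℓ f s t - iteratedDerivWithin ℓ f s x‖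
      ≤ L * |t - x| ^ γ) {t : ℝ} (ht : t ∈ s) :
    ‖f t - taylorWithinEval f ℓ s x t‖ ≤ L * |t - x| ^ (γ + ℓ) := by
  induction ℓ generalizing f t with
  | zero => simpa using hhol t ht
  | succ ℓ ih =>
    have hderiv_le : ∀ y ∈ s, ‖derivWithin f s y - taylorWithinEval (derivWithin f s) ℓ s x y‖
        ≤ L * |y - x| ^ (γ + ℓ) := fun y hy =>
      ih (fun j hj => by simpa only [iteratedDerivWithin_succ'] using hf (j + 1) (by omega))
        (by simpa only [iteratedDerivWithin_succ'] using hhol) hy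
    have hderiv : ∀ y ∈ s, HasDerivWithinAt (fun y => f y - taylorWithinEval f (ℓ + 1) s x y)
        (derivWithin f s y - taylorWithinEval (derivWithin f s) ℓ s x y) s y := fun y hy =>
      (by simpa using (hf 0 ℓ.succ_pos y hy).hasDerivWithinAt :
        HasDerivWithinAt f (derivWithin f s y) s y).sub
        (hasDerivAt_taylorWithinEval_succ f ℓ).hasDerivWithinAt
    have hseg : segment ℝ x t ⊆ s := hs.segment_subset hx ht
    have hmvt := Convex.norm_image_sub_le_of_norm_hasDerivWithin_le
      (C := L * |t - x| ^ (γ + ℓ)) (fun y hy => (hderiv y (hseg hy)).mono hseg)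
      (fun y hy => (hderiv_le y (hseg hy)).trans <| by
        have hyt : |y - x| ≤ |t - x| := norm_sub_le_of_mem_segment hy
        gcongr)
      (convex_segment x t) (left_mem_segment ℝ x t) (right_mem_segment ℝ x t)
    rw [taylorWithinEval_self, sub_self, sub_zero, Real.norm_eq_abs, mul_assoc] at hmvt
    rcases eq_or_ne t x with rfl | htx
    · simp [Real.zero_rpow (by positivity : γ + (ℓ + 1) ≠ 0)]
    · rwa [← Real.rpow_add_one (abs_pos.2 (sub_ne_zero.2 htx)).ne', add_assoc,
        ← Nat.cast_succ] at hmvt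

lemma HolderClass.exists_taylor {ℓ : ℕ} {β L : ℝ} (hβ : (ℓ : ℝ) ≤ β) (hL : 0 ≤ L) {f : ℝ → ℝ}
    (hf : f ∈ HolderClass ℓ β L) {x : ℝ} (hx : x ∈ Set.Icc (0 : ℝ) 1) :
    ∃ θ : Fin (ℓ + 1) → ℝ, θ 0 = f x ∧ ∀ t ∈ Set.Icc (0 : ℝ) 1,
      |f t - ∑ j : Fin (ℓ + 1), (t - x) ^ (j : ℕ) / ((j : ℕ)! : ℝ) * θ j| ≤ L * |t - x| ^ β := by
  refine ⟨fun j => iteratedDerivWithin j f (Set.Icc 0 1) x, by simp, fun t ht => ?_⟩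
  have h := norm_sub_taylorWithinEval_le_of_holder (convex_Icc (0 : ℝ) 1) hx hL (sub_nonneg.2 hβ)
    hf.1 (fun t ht => hf.2 t ht x hx) ht
  rw [taylor_within_apply, ← Fin.sum_univ_eq_sum_range
    (fun j => ((j ! : ℝ)⁻¹ * (t - x) ^ j) • iteratedDerivWithin j f (Set.Icc 0 1) x)] at h
  simpa [div_eq_inv_mul] using h

end Taylor

section GaussianMoments

/-- The moment `E (c + d |Z|)^r` of a standard normal `Z`, which dominates `E |m + σ Z|^r` whenever
`|m| ≤ c` and `σ ≤ d`. -/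
noncomputable def affineGaussianMoment (c d r : ℝ) : ℝ :=
  (∫⁻ z, ENNReal.ofReal ((c + d * |z|) ^ r) ∂gaussianReal 0 1).toReal

lemma affineGaussianMoment_nonneg (c d r : ℝ) : 0 ≤ affineGaussianMoment c d r :=
  ENNReal.toReal_nonneg

lemma ofReal_affineGaussianMoment {c d r : ℝ} (hc : 0 ≤ c) (hd : 0 ≤ d) (hr : 0 < r) :
    ENNReal.ofReal (affineGaussianMoment c d r)
      = ∫⁻ z, ENNReal.ofReal ((c + d * |z|) ^ r) ∂gaussianReal 0 1 := by
  have hmem : MemLp (fun z : ℝ => c + d * |z|) (ENNReal.ofReal r) (gaussianReal 0 1) :=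
    (memLp_const c).add
      ((memLp_id_gaussianReal' (ENNReal.ofReal r) ENNReal.ofReal_ne_top).norm.const_mul d)
  have hfin := lintegral_rpow_enorm_lt_top_of_eLpNorm_lt_top (by simpa using hr)
    ENNReal.ofReal_ne_top hmem.2
  rw [ENNReal.toReal_ofReal hr.le] at hfin
  refine ENNReal.ofReal_toReal (ne_of_lt ?_)
  convert hfin using 3 with z
  have h0 : 0 ≤ c + d * |z| := by positivity
  rw [Real.enorm_of_nonneg h0, ENNReal.ofReal_rpow_of_nonneg h0 hr.le]

lemma gaussianReal_eq_map_standard (m : ℝ) (v : ℝ≥0) :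
    gaussianReal m v = (gaussianReal 0 1).map fun z => √v * z + m := by
  have hcomp : (fun z => √v * z + m) = (fun z => z + m) ∘ fun z => √v * z := rfl
  rw [hcomp, ← Measure.map_map (by fun_prop) (by fun_prop), gaussianReal_map_const_mul,
    gaussianReal_map_add_const]
  congr 1
  · ring
  · ext; simp

lemma lintegral_abs_rpow_gaussianReal_le {r c d q m : ℝ} {v : ℝ≥0} (hr : 0 < r) (hc : 0 ≤ c)
    (hd : 0 ≤ d) (hq : 0 ≤ q) (hm : |m| ≤ c * q) (hv : √v ≤ d * q) :
    ∫⁻ z, ENNReal.ofReal (|z| ^ r) ∂gaussianReal m v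
      ≤ ENNReal.ofReal (affineGaussianMoment c d r * q ^ r) := by
  rw [gaussianReal_eq_map_standard, lintegral_map (by fun_prop) (by fun_prop), mul_comm,
    ENNReal.ofReal_mul (by positivity), ofReal_affineGaussianMoment hc hd hr,
    ← lintegral_const_mul _ (by fun_prop)]
  refine lintegral_mono fun z => ?_
  rw [← ENNReal.ofReal_mul (by positivity), ← Real.mul_rpow hq (by positivity)]
  refine ENNReal.ofReal_le_ofReal (Real.rpow_le_rpow (abs_nonneg _) ?_ hr.le)
  calc |√v * z + m| ≤ √v * |z| + |m| := by
        simpa only [abs_mul, abs_of_nonneg (Real.sqrt_nonneg _)] using abs_add_le (√v * z) m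
    _ ≤ d * q * |z| + c * q := by gcongr
    _ = q * (c + d * |z|) := by ring

end GaussianMoments

namespace Scheme

variable {n : ℕ} {S : Scheme n} {ℓ : ℕ} {x : ℝ}

section Information

variable (S ℓ x) in
/-- Scale `k` carries information at least `κ` on the first coordinate of the parameter:
`κ e₁ e₁ᵀ ≼ B_k`, written as an inequality of quadratic forms. -/
def HasInformation (k : ℕ) (κ : ℝ) : Prop :=
  ∀ d : Fin (ℓ + 1) → ℝ, κ * d 0 ^ 2 ≤ d ⬝ᵥ (S.B ℓ x k *ᵥ d)

variable {k : ℕ} {κ : ℝ}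

lemma HasInformation.le_B_zero_zero (h : S.HasInformation ℓ x k κ) : κ ≤ S.B ℓ x k 0 0 := by
  simpa using h (Pi.single 0 1)

lemma HasInformation.sum_smoother_sq_mul_varModel_le (h : S.HasInformation ℓ x k κ) (hκ : 0 < κ)
    (hdet : IsUnit (S.B ℓ x k).det) (hw : ∀ i, S.w k i * S.w k i = S.w k i)
    (hv : ∀ i, 0 < S.varModel i) : ∑ i, S.smoother ℓ x k i ^ 2 * S.varModel i ≤ 1 / κ :=
  (sum_smoother_sq_mul_varModel hdet hw hv).trans_le (inv_apply_self_le hdet hκ h)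

lemma CondBasic.one_div_le_h (hS : S.CondBasic) (hk : k ∈ Finset.Icc 1 S.K) :
    1 / (2 * (n : ℝ)) ≤ S.h k := by
  obtain ⟨hK, _, _, hh1, _, hmono⟩ := hS
  rw [Finset.mem_Icc] at hk
  exact hh1.trans (hmono.monotoneOn ⟨le_rfl, hK⟩ ⟨hk.1, hk.2⟩ hk.1)

lemma CondBasic.h_pos (hS : S.CondBasic) (hn : 0 < n) (hk : k ∈ Finset.Icc 1 S.K) : 0 < S.h k :=
  lt_of_lt_of_le (by positivity) (hS.one_div_le_h hk)

lemma CondLp1.hasInformation {lam₀ vmax : ℝ} (h : S.CondLp1 ℓ x lam₀ vmax)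
    (hlam : 0 ≤ lam₀) (hv : 0 ≤ vmax) (hk : k ∈ Finset.Icc 1 S.K) (hh : 0 ≤ S.h k) :
    S.HasInformation ℓ x k (n * S.h k * lam₀ / vmax) := fun d => by
  have hpsd := (h k hk).dotProduct_mulVec_nonneg d
  rw [Matrix.sub_mulVec, dotProduct_sub, Matrix.smul_mulVec, dotProduct_smul, star_trivial,
    smul_eq_mul, sub_nonneg] at hpsd
  refine le_trans ?_ hpsd
  gcongr
  have hform : d ⬝ᵥ (Matrix.diagonal (fun j : Fin (ℓ + 1) => (S.h k ^ (j : ℕ)) ^ 2) *ᵥ d)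
      = ∑ j : Fin (ℓ + 1), (S.h k ^ (j : ℕ) * d j) ^ 2 := by
    simp only [dotProduct, Matrix.mulVec_diagonal]
    exact Finset.sum_congr rfl fun j _ => by ring
  simpa [hform] using Finset.single_le_sum (f := fun j : Fin (ℓ + 1) => (S.h k ^ (j : ℕ) * d j) ^ 2)
    (fun j _ => sq_nonneg _) (Finset.mem_univ 0)

lemma CondLp1.isUnit_det {lam₀ vmax : ℝ} (h : S.CondLp1 ℓ x lam₀ vmax) (hn : 0 < n)
    (hlam : 0 < lam₀) (hv : 0 < vmax) (hk : k ∈ Finset.Icc 1 S.K) (hh : 0 < S.h k) :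
    IsUnit (S.B ℓ x k).det := by
  have hdiag : ((n * S.h k * lam₀ / vmax) •
      Matrix.diagonal fun j : Fin (ℓ + 1) => (S.h k ^ (j : ℕ)) ^ 2).PosDef := by
    rw [← Matrix.diagonal_smul]
    exact Matrix.PosDef.diagonal fun j => by simp only [Pi.smul_apply, smul_eq_mul]; positivity
  have hB := hdiag.posSemidef_add (h k hk)
  rw [sub_add_cancel] at hB
  exact (Matrix.isUnit_iff_isUnit_det _).1 hB.isUnit

lemma CondB.hasInformation_div {u₀ u : ℝ} (h : S.CondB ℓ x u₀ u) (hu : 0 < u) (hk : 1 ≤ k)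
    (hkK : k < S.K) (hκ : S.HasInformation ℓ x (k + 1) κ) :
    S.HasInformation ℓ x k (κ / u) := fun d => by
  have hpsd := (h (k + 1) (by omega) hkK).2.dotProduct_mulVec_nonneg d
  rw [Matrix.sub_mulVec, dotProduct_sub, Matrix.smul_mulVec, dotProduct_smul, star_trivial,
    smul_eq_mul, sub_nonneg, Nat.add_sub_cancel] at hpsd
  rw [div_mul_eq_mul_div, div_le_iff₀' hu]
  exact (hκ d).trans hpsd

end Information

section NumberOfScales

lemma B_zero_zero (S : Scheme n) (ℓ : ℕ) (x : ℝ) (k : ℕ) :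
    S.B ℓ x k 0 0 = ∑ i, S.w k i / (S.varModel i : ℝ) := by
  rw [B, Matrix.mul_apply]
  exact Finset.sum_congr rfl fun i _ => by rw [Psi_mul_W_apply]; simp [Psi]

lemma CondB.pow_mul_B_zero_zero_le {u₀ u : ℝ} (h : S.CondB ℓ x u₀ u) (hu₀ : 0 ≤ u₀) {j : ℕ}
    (hj : j + 1 ≤ S.K) : u₀ ^ j * S.B ℓ x 1 0 0 ≤ S.B ℓ x (j + 1) 0 0 := by
  induction j with
  | zero => simp
  | succ j ih =>
    have hdiag := (h (j + 1 + 1) (by omega) hj).1.diag_nonneg (i := 0)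
    rw [Matrix.sub_apply, Matrix.smul_apply, smul_eq_mul, sub_nonneg, Nat.add_sub_cancel] at hdiag
    rw [pow_succ', mul_assoc]
    exact (mul_le_mul_of_nonneg_left (ih (by omega)) hu₀).trans hdiag

lemma B_zero_zero_le {vmin : ℝ} {k : ℕ} (hw : ∀ i, S.w k i ∈ Set.Icc (0 : ℝ) 1) (hvmin : 0 < vmin)
    (hv : ∀ i, vmin ≤ S.varModel i) : S.B ℓ x k 0 0 ≤ n / vmin := by
  rw [B_zero_zero]
  calc ∑ i, S.w k i / (S.varModel i : ℝ) ≤ ∑ _i : Fin n, 1 / vmin :=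
        Finset.sum_le_sum fun i _ => div_le_div₀ zero_le_one (hw i).2 hvmin (hv i)
    _ = n / vmin := by simp [div_eq_mul_inv]

lemma CondB.pow_le {u₀ u vmin vmax lam₀ : ℝ} (hB : S.CondB ℓ x u₀ u) (hS : S.CondBasic)
    (hS1 : S.CondS1 vmin vmax) (hLp1 : S.CondLp1 ℓ x lam₀ vmax) (hn : 0 < n) (hvmin : 0 < vmin)
    (hvmax : 0 < vmax) (hlam : 0 < lam₀) (hu₀ : 0 ≤ u₀) :
    u₀ ^ (S.K - 1) ≤ 2 * vmax / (lam₀ * vmin) * n := by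
  have h1 : 1 ∈ Finset.Icc 1 S.K := Finset.mem_Icc.2 ⟨le_rfl, hS.1⟩
  have hfirst : lam₀ / (2 * vmax) ≤ S.B ℓ x 1 0 0 :=
    calc lam₀ / (2 * vmax) = n * (1 / (2 * (n : ℝ))) * lam₀ / vmax := by field_simp
      _ ≤ n * S.h 1 * lam₀ / vmax := by gcongr; exact hS.one_div_le_h h1
      _ ≤ S.B ℓ x 1 0 0 :=
        (hLp1.hasInformation hlam.le hvmax.le h1 (hS.h_pos hn h1).le).le_B_zero_zero
  have hgrowth := hB.pow_mul_B_zero_zero_le hu₀ (j := S.K - 1) (by have := hS.1; omega)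
  rw [Nat.sub_add_cancel hS.1] at hgrowth
  have hlast : S.B ℓ x S.K 0 0 ≤ n / vmin :=
    B_zero_zero_le (hS.2.2.1 S.K (Finset.mem_Icc.2 ⟨hS.1, le_rfl⟩)) hvmin fun i => (hS1 i).1
  have hprod : u₀ ^ (S.K - 1) * (lam₀ / (2 * vmax)) ≤ n / vmin :=
    (mul_le_mul_of_nonneg_left hfirst (by positivity)).trans (hgrowth.trans hlast)
  rw [← le_div_iff₀ (by positivity)] at hprod
  exact hprod.trans_eq (by field_simp)

lemma natCast_le_mul_log_of_pow_le {u₀ c N : ℝ} {K : ℕ} (hK : 1 ≤ K) (hu₀ : 1 < u₀)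
    (h : u₀ ^ (K - 1) ≤ c * N) (hc : 0 < c) (hN : 0 < N) (hlog : 1 ≤ Real.log N)
    (hlogc : Real.log c ≤ Real.log N) : (K : ℝ) ≤ (1 + 2 / Real.log u₀) * Real.log N := by
  have hlu₀ : 0 < Real.log u₀ := Real.log_pos hu₀
  have hloglog := Real.log_le_log (by positivity) h
  rw [Real.log_pow, Real.log_mul hc.ne' hN.ne', Nat.cast_sub hK, Nat.cast_one] at hloglog
  have hK1 : (K : ℝ) - 1 ≤ 2 * Real.log N / Real.log u₀ := by
    rw [le_div_iff₀ hlu₀]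
    linarith
  calc (K : ℝ) ≤ Real.log N + 2 * Real.log N / Real.log u₀ := by linarith
    _ = (1 + 2 / Real.log u₀) * Real.log N := by ring

end NumberOfScales

section ModelingBias

lemma CondProd.eq_zero (h : S.CondProd) {l k : ℕ} (hl : 1 ≤ l) (hlk : l ≤ k) (hkK : k ≤ S.K)
    {i : Fin n} (hi : S.w k i = 0) : S.w l i = 0 := by
  rw [← h l k hl hlk hkK i, hi, mul_zero]

variable (S ℓ x) in
/-- The remainder of the regression function `f` after subtraction of the polynomial with
coefficients `θ`, at the design points which are seen by scale `k`. -/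
noncomputable def residual (f : ℝ → ℝ) (θ : Fin (ℓ + 1) → ℝ) (k : ℕ) : Fin n → ℝ := fun i =>
  if S.w k i = 0 then 0 else f (S.X i) - ((S.Psi ℓ x)ᵀ *ᵥ θ) i

variable (S ℓ x) in
/-- The modeling bias of scale `k`: twice the Kullback–Leibler divergence between the laws with the
variances of the working model whose means differ by the residual. -/
noncomputable def modelingBias (f : ℝ → ℝ) (θ : Fin (ℓ + 1) → ℝ) (k : ℕ) : ℝ :=
  ∑ i, S.residual ℓ x f θ k i ^ 2 / S.varModel i

variable {f : ℝ → ℝ} {θ : Fin (ℓ + 1) → ℝ} {k : ℕ}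

lemma qmle_eq_qmle_residual_add {l : ℕ} (hl : IsUnit (S.B ℓ x l).det)
    (hlk : ∀ i, S.w k i = 0 → S.w l i = 0) (y : Fin n → ℝ) :
    S.qmle ℓ x l y = S.qmle ℓ x l (y + (S.residual ℓ x f θ k - fun i => f (S.X i))) + θ := by
  refine qmle_eq_qmle_add hl fun i hi => ?_
  simp [residual, mt (hlk i) hi]

lemma bias_eq_sum_smoother_mul_residual (hdet : IsUnit (S.B ℓ x k).det) (hθ : θ 0 = f x) :
    S.bias ℓ x f k = ∑ i, S.smoother ℓ x k i * S.residual ℓ x f θ k i := by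
  rw [bias, qmle_eq_qmle_residual_add (f := f) (θ := θ) hdet (fun _ => id), add_sub_cancel,
    Pi.add_apply, hθ, add_sub_cancel_right, qmle_apply_zero]

lemma bias_sq_le (hdet : IsUnit (S.B ℓ x k).det) (hθ : θ 0 = f x)
    (hv : ∀ i, 0 < S.varModel i) :
    S.bias ℓ x f k ^ 2
      ≤ (∑ i, S.smoother ℓ x k i ^ 2 * S.varModel i) * S.modelingBias ℓ x f θ k := by
  rw [bias_eq_sum_smoother_mul_residual hdet hθ]
  refine Finset.sum_sq_le_sum_mul_sum_of_sq_le_mul _ (fun i _ => by positivity)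
    (fun i _ => by positivity) fun i _ => le_of_eq ?_
  have := (NNReal.coe_pos.2 (hv i)).ne'
  field_simp

lemma HasInformation.abs_bias_le {κ Δ : ℝ} (h : S.HasInformation ℓ x k κ) (hκ : 0 < κ)
    (hdet : IsUnit (S.B ℓ x k).det) (hw : ∀ i, S.w k i * S.w k i = S.w k i)
    (hv : ∀ i, 0 < S.varModel i) (hθ : θ 0 = f x) (hΔ : S.modelingBias ℓ x f θ k ≤ Δ) :
    |S.bias ℓ x f k| ≤ √Δ * (1 / √κ) := by
  have hmb : 0 ≤ S.modelingBias ℓ x f θ k := Finset.sum_nonneg fun i _ => by positivity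
  rw [← Real.sqrt_one, ← Real.sqrt_div zero_le_one, ← Real.sqrt_mul (hmb.trans hΔ), mul_comm Δ]
  exact Real.abs_le_sqrt <| (bias_sq_le hdet hθ hv).trans <|
    mul_le_mul (h.sum_smoother_sq_mul_varModel_le hκ hdet hw hv) hΔ hmb (by positivity)

lemma CondLp2.card_support_le {a₀ : ℝ} (h : S.CondLp2 a₀) (hS : S.CondBasic) (hLp3 : S.CondLp3 x)
    (hn : 0 < n) (ha₀ : 0 ≤ a₀) (hx : x ∈ Set.Icc (0 : ℝ) 1) (hk : k ∈ Finset.Icc 1 S.K) :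
    (({i | S.w k i ≠ 0} : Finset (Fin n)).card : ℝ) ≤ 2 * a₀ * n * S.h k := by
  have hn' : (0 : ℝ) < n := by exact_mod_cast hn
  have hh := hS.h_pos hn hk
  obtain ⟨a, ha⟩ : ∃ a, a = max (x - S.h k) 0 := ⟨_, rfl⟩
  obtain ⟨b, hb⟩ : ∃ b, b = min (x + S.h k) 1 := ⟨_, rfl⟩
  have hab : a ≤ b := by
    rw [ha, hb]
    exact max_le (le_min (by linarith) (by linarith [hx.2]))
      (le_min (by linarith [hx.1]) zero_le_one)
  have hsub : (({i | S.w k i ≠ 0} : Finset (Fin n)) : Set (Fin n)) ⊆ {i | S.X i ∈ Set.Icc a b} := by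
    intro i hi
    have hloc : |S.X i - x| ≤ S.h k := by
      by_contra! hfar
      exact (Finset.mem_filter.1 hi).2 (hLp3 k hk i hfar)
    have hX := hS.2.1 i
    rw [abs_le] at hloc
    rw [ha, hb]
    exact ⟨max_le (by linarith) hX.1, le_min (by linarith) hX.2⟩
  have hlen : max (b - a) (1 / (n : ℝ)) ≤ 2 * S.h k := by
    refine max_le ?_ ?_
    · linarith [min_le_left (x + S.h k) 1, le_max_left (x - S.h k) 0]
    · calc 1 / (n : ℝ) = 2 * (1 / (2 * (n : ℝ))) := by field_simp
        _ ≤ 2 * S.h k := by gcongr; exact hS.one_div_le_h hk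
  have hcount := h a b (ha ▸ le_max_right _ _) hab (hb ▸ min_le_right _ _)
  rw [one_div, inv_mul_le_iff₀ hn', ← one_div] at hcount
  calc (({i | S.w k i ≠ 0} : Finset (Fin n)).card : ℝ) ≤ {i | S.X i ∈ Set.Icc a b}.ncard := by
        rw [← Set.ncard_coe_finset]
        exact Nat.cast_le.2 (Set.ncard_le_ncard hsub (Set.toFinite _))
    _ ≤ n * (a₀ * (2 * S.h k)) := hcount.trans (by gcongr)
    _ = 2 * a₀ * n * S.h k := by ring

lemma modelingBias_le {vmin a₀ β L : ℝ} (hS : S.CondBasic) (hLp2 : S.CondLp2 a₀)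
    (hLp3 : S.CondLp3 x) (hn : 0 < n) (hvmin : 0 < vmin) (hv : ∀ i, vmin ≤ S.varModel i)
    (ha₀ : 0 ≤ a₀) (hβ : 0 ≤ β) (hL : 0 ≤ L) (hx : x ∈ Set.Icc (0 : ℝ) 1)
    (hk : k ∈ Finset.Icc 1 S.K)
    (hf : ∀ i, |f (S.X i) - ((S.Psi ℓ x)ᵀ *ᵥ θ) i| ≤ L * |S.X i - x| ^ β) :
    S.modelingBias ℓ x f θ k ≤ 2 * a₀ / vmin * (n * S.h k ^ (2 * β + 1) * L ^ 2) := by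
  have hh := hS.h_pos hn hk
  have hsupp : S.modelingBias ℓ x f θ k
      = ∑ i with S.w k i ≠ 0, (f (S.X i) - ((S.Psi ℓ x)ᵀ *ᵥ θ) i) ^ 2 / S.varModel i := by
    rw [modelingBias, Finset.sum_filter]
    refine Finset.sum_congr rfl fun i _ => ?_
    by_cases hi : S.w k i = 0 <;> simp [residual, hi]
  have hterm : ∀ i ∈ ({i | S.w k i ≠ 0} : Finset (Fin n)),
      (f (S.X i) - ((S.Psi ℓ x)ᵀ *ᵥ θ) i) ^ 2 / S.varModel i ≤ (L * S.h k ^ β) ^ 2 / vmin := by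
    intro i hi
    have hloc : |S.X i - x| ≤ S.h k := by
      by_contra! hfar
      exact (Finset.mem_filter.1 hi).2 (hLp3 k hk i hfar)
    refine div_le_div₀ (sq_nonneg _) ?_ hvmin (hv i)
    rw [← sq_abs (f (S.X i) - _)]
    gcongr
    exact (hf i).trans (by gcongr)
  calc S.modelingBias ℓ x f θ k
      ≤ ({i | S.w k i ≠ 0} : Finset (Fin n)).card • ((L * S.h k ^ β) ^ 2 / vmin) :=
        hsupp.trans_le (Finset.sum_le_card_nsmul _ _ _ hterm)
    _ ≤ 2 * a₀ * n * S.h k * ((L * S.h k ^ β) ^ 2 / vmin) := by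
        rw [nsmul_eq_mul]
        gcongr
        exact hLp2.card_support_le hS hLp3 hn ha₀ hx hk
    _ = 2 * a₀ / vmin * (n * S.h k ^ (2 * β + 1) * L ^ 2) := by
        rw [mul_pow, ← Real.rpow_mul_natCast hh.le, Real.rpow_add_one hh.ne', Nat.cast_ofNat,
          mul_comm β 2]
        ring

end ModelingBias

end Scheme

lemma add_add_rpow_le {a b c r : ℝ} (ha : 0 ≤ a) (hb : 0 ≤ b) (hc : 0 ≤ c) (hr : 0 ≤ r) :
    (a + b + c) ^ r ≤ 3 ^ r * (a ^ r + b ^ r + c ^ r) := by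
  have har := Real.rpow_nonneg ha r
  have hbr := Real.rpow_nonneg hb r
  have hcr := Real.rpow_nonneg hc r
  have key : ∀ m, 0 ≤ m → a ≤ m → b ≤ m → c ≤ m → m ^ r ≤ a ^ r + b ^ r + c ^ r →
      (a + b + c) ^ r ≤ 3 ^ r * (a ^ r + b ^ r + c ^ r) := fun m hm ham hbm hcm hle =>
    calc (a + b + c) ^ r ≤ (3 * m) ^ r := by gcongr; linarith
      _ = 3 ^ r * m ^ r := Real.mul_rpow zero_le_three hm
      _ ≤ 3 ^ r * (a ^ r + b ^ r + c ^ r) := by gcongr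
  obtain hab | hba := le_total a b <;> obtain hbc | hcb := le_total b c <;>
    obtain hac | hca := le_total a c
  · exact key c hc hac hbc le_rfl (by linarith)
  · exact key c hc (hab.trans hbc) hbc le_rfl (by linarith)
  · exact key b hb hab le_rfl hcb (by linarith)
  · exact key b hb hab le_rfl hcb (by linarith)
  · exact key c hc hac hbc le_rfl (by linarith)
  · exact key a ha le_rfl hba hca (by linarith)
  · exact key a ha le_rfl hba (hcb.trans hba) (by linarith)
  · exact key a ha le_rfl hba hca (by linarith)

namespace Scheme

variable {n : ℕ} {S : Scheme n} {ℓ : ℕ} {x : ℝ}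

section ErrorAtFixedScale

variable {k : ℕ} {f : ℝ → ℝ} {κ δ : ℝ}

instance isProbabilityMeasure_trueLaw (f : ℝ → ℝ) : IsProbabilityMeasure (S.trueLaw f) := by
  unfold trueLaw
  infer_instance

lemma CondS.nonneg (h : S.CondS δ) (hn : 0 < n) : 0 ≤ δ := by
  linarith [(h ⟨0, hn⟩).1.trans (h ⟨0, hn⟩).2]

lemma CondS.le_varTrue (h : S.CondS δ) (hv : ∀ i, 0 < S.varModel i) (i : Fin n) :
    (1 - δ) * S.varModel i ≤ S.varTrue i :=
  (le_div_iff₀ (NNReal.coe_pos.2 (hv i))).1 (h i).1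

lemma CondS.varTrue_le (h : S.CondS δ) (hv : ∀ i, 0 < S.varModel i) (i : Fin n) :
    (S.varTrue i : ℝ) ≤ (1 + δ) * S.varModel i :=
  (div_le_iff₀ (NNReal.coe_pos.2 (hv i))).1 (h i).2

variable (S ℓ x) in
lemma hasLaw_qmle_sub (f : ℝ → ℝ) (k : ℕ) :
    HasLaw (fun y => S.qmle ℓ x k y 0 - f x) (gaussianReal (S.bias ℓ x f k)
      (∑ i, S.smoother ℓ x k i ^ 2 * S.varTrue i).toNNReal) (S.trueLaw f) := by
  have hlin := hasLaw_sum_mul_pi_gaussianReal (fun i => f (S.X i)) S.varTrue (S.smoother ℓ x k)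
  have hshift : HasLaw (fun t => t - f x) (gaussianReal (S.bias ℓ x f k)
      (∑ i, S.smoother ℓ x k i ^ 2 * S.varTrue i).toNNReal)
      (gaussianReal (∑ i, S.smoother ℓ x k i * f (S.X i))
        (∑ i, S.smoother ℓ x k i ^ 2 * S.varTrue i).toNNReal) := by
    rw [bias, qmle_apply_zero]
    exact ⟨by fun_prop, gaussianReal_map_sub_const _⟩
  simp only [qmle_apply_zero]
  exact hshift.comp hlin

variable (S ℓ x) in
lemma stdDev_eq_sqrt_sum (f : ℝ → ℝ) (k : ℕ) :
    S.stdDev ℓ x f k = √(∑ i, S.smoother ℓ x k i ^ 2 * S.varTrue i) := by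
  have hlin := hasLaw_sum_mul_pi_gaussianReal (fun i => f (S.X i)) S.varTrue (S.smoother ℓ x k)
  simp only [stdDev, qmle_apply_zero]
  rw [trueLaw, hlin.variance_eq, variance_id_gaussianReal, Real.coe_toNNReal]
  positivity

lemma HasInformation.sqrt_sum_smoother_sq_mul_varTrue_le (h : S.HasInformation ℓ x k κ)
    (hκ : 0 < κ) (hdet : IsUnit (S.B ℓ x k).det) (hw : ∀ i, S.w k i * S.w k i = S.w k i)
    (hv : ∀ i, 0 < S.varModel i) (hCS : S.CondS δ) (hδ : δ ≤ 1) :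
    √(∑ i, S.smoother ℓ x k i ^ 2 * S.varTrue i) ≤ √2 * (1 / √κ) := by
  rw [← Real.sqrt_one, ← Real.sqrt_div zero_le_one, ← Real.sqrt_mul zero_le_two]
  refine Real.sqrt_le_sqrt ?_
  calc ∑ i, S.smoother ℓ x k i ^ 2 * S.varTrue i
      ≤ ∑ i, 2 * (S.smoother ℓ x k i ^ 2 * S.varModel i) := by
        refine Finset.sum_le_sum fun i _ => ?_
        rw [mul_left_comm]
        gcongr
        exact (hCS.varTrue_le hv i).trans (by gcongr; linarith)
    _ = 2 * ∑ i, S.smoother ℓ x k i ^ 2 * S.varModel i := (Finset.mul_sum ..).symm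
    _ ≤ 2 * (1 / κ) := by gcongr; exact h.sum_smoother_sq_mul_varModel_le hκ hdet hw hv

lemma FirstAccepted.abs_bias_one_le {Cw : ℝ} (h : S.FirstAccepted ℓ x f Cw) :
    |S.bias ℓ x f 1| ≤ Cw * S.stdDev ℓ x f 1 := by
  have hsup := le_ciSup (f := fun l : Set.Icc 1 1 => |S.bias ℓ x f l|)
    (Set.finite_range _).bddAbove ⟨1, Set.right_mem_Icc.2 le_rfl⟩
  exact hsup.trans h

end ErrorAtFixedScale

section Propagation

variable {k : ℕ}

variable (S ℓ x) in
/-- The squared `B_k`-norm of `θ̃_k - θ̂_k`, the statistic in the propagation conditions `(PC)`. -/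
noncomputable def propagationStat (k : ℕ) (y : Fin n → ℝ) : ℝ :=
  (S.qmle ℓ x k y - S.lastAccepted ℓ x k y) ⬝ᵥ
    (S.B ℓ x k *ᵥ (S.qmle ℓ x k y - S.lastAccepted ℓ x k y))

lemma measurable_propagationStat (hK : 1 ≤ S.K) (k : ℕ) :
    Measurable (S.propagationStat ℓ x k) :=
  (continuous_id.dotProduct (continuous_const.matrix_mulVec continuous_id)).measurable.comp
    ((S.measurable_qmle ℓ x k).sub (measurable_lastAccepted ℓ x hK k))

lemma propagationStat_one (hK : 1 ≤ S.K) (y : Fin n → ℝ) : S.propagationStat ℓ x 1 y = 0 := by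
  rw [propagationStat, lastAccepted, min_eq_left (khat_mem hK y).1, sub_self, zero_dotProduct]

lemma propagationStat_congr (hK : 1 ≤ S.K) (hk : k ∈ Finset.Icc 1 S.K)
    (hdet : ∀ l ∈ Finset.Icc 1 k, IsUnit (S.B ℓ x l).det) {y y' : Fin n → ℝ}
    {θ : Fin (ℓ + 1) → ℝ} (h : ∀ l ∈ Finset.Icc 1 k, S.qmle ℓ x l y = S.qmle ℓ x l y' + θ) :
    S.propagationStat ℓ x k y = S.propagationStat ℓ x k y' := by
  rw [propagationStat, propagationStat, qmle_sub_lastAccepted_congr hK hk hdet h]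

lemma propagationStat_eq_of_Psi_mul_W_eq (hK : 1 ≤ S.K) (hk : k ∈ Finset.Icc 1 S.K)
    (hdet : ∀ l ∈ Finset.Icc 1 k, IsUnit (S.B ℓ x l).det) {y y' : Fin n → ℝ}
    (h : ∀ c : Fin k × Fin (ℓ + 1), ∑ i, (S.Psi ℓ x * S.W (c.1 + 1)) c.2 i * y i
      = ∑ i, (S.Psi ℓ x * S.W (c.1 + 1)) c.2 i * y' i) :
    S.propagationStat ℓ x k y = S.propagationStat ℓ x k y' := by
  refine propagationStat_congr hK hk hdet (θ := 0) fun l hl => ?_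
  rw [Finset.mem_Icc] at hl
  have hscore : (S.Psi ℓ x * S.W l) *ᵥ y = (S.Psi ℓ x * S.W l) *ᵥ y' := funext fun j => by
    have := h (⟨l - 1, by omega⟩, j)
    rwa [Nat.sub_add_cancel hl.1] at this
  rw [add_zero, qmle, hscore, qmle]

lemma lintegral_propagationStat_trueLaw (hK : 1 ≤ S.K) (hk : k ∈ Finset.Icc 1 S.K)
    (hdet : ∀ l ∈ Finset.Icc 1 k, IsUnit (S.B ℓ x l).det) (hProd : S.CondProd) (f : ℝ → ℝ)
    (θ : Fin (ℓ + 1) → ℝ) {F : ℝ → ℝ≥0∞} (hF : Measurable F) :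
    ∫⁻ y, F (S.propagationStat ℓ x k y) ∂S.trueLaw f
      = ∫⁻ y, F (S.propagationStat ℓ x k y)
          ∂Measure.pi fun i => gaussianReal (S.residual ℓ x f θ k i) (S.varTrue i) := by
  have hlaw := hasLaw_add_pi_gaussianReal (fun i => f (S.X i)) S.varTrue
    (S.residual ℓ x f θ k - fun i => f (S.X i))
  simp only [Pi.sub_apply, add_sub_cancel] at hlaw
  rw [trueLaw, ← hlaw.lintegral_comp (f := fun y => F (S.propagationStat ℓ x k y))
    (hF.comp (measurable_propagationStat hK k)).aemeasurable]
  refine lintegral_congr fun y => congrArg F <|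
    propagationStat_congr hK hk hdet (θ := θ) fun l hl => ?_
  have hlk := Finset.mem_Icc.1 hl
  exact qmle_eq_qmle_residual_add (hdet l hl)
    (fun i => hProd.eq_zero hlk.1 hlk.2 (Finset.mem_Icc.1 hk).2) y

lemma lintegral_propagationStat_rpow_le {r α δ : ℝ} (hK : 1 ≤ S.K) (hk : k ∈ Finset.Icc 2 S.K)
    (hdet : ∀ l ∈ Finset.Icc 1 k, IsUnit (S.B ℓ x l).det) (hProd : S.CondProd)
    (hv : ∀ i, 0 < S.varModel i) (hPC : S.CondPC ℓ x r α) (hCS : S.CondS δ) (hδ0 : 0 ≤ δ)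
    (hδ1 : δ < 1) (f : ℝ → ℝ) (θ : Fin (ℓ + 1) → ℝ) :
    ∫⁻ y, ENNReal.ofReal (|S.propagationStat ℓ x k y| ^ (r / 2)) ∂S.trueLaw f
      ≤ ENNReal.ofReal (α * chiSqMoment (ℓ + 1) r)
        + ENNReal.ofReal (Real.exp (S.modelingBias ℓ x f θ k / (1 - δ))
          * (1 / √(1 - δ ^ 2)) ^ (k * (ℓ + 1))) := by
  obtain ⟨hk2, hkK⟩ := Finset.mem_Icc.1 hk
  have hk1 : k ∈ Finset.Icc 1 S.K := Finset.mem_Icc.2 ⟨by omega, hkK⟩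
  have hstat := measurable_propagationStat (ℓ := ℓ) (x := x) hK k
  have hsq : ∀ y, ENNReal.ofReal (|S.propagationStat ℓ x k y| ^ (r / 2)) ^ 2
      = ENNReal.ofReal (|S.propagationStat ℓ x k y| ^ r) := fun y => by
    rw [← ENNReal.ofReal_pow (by positivity), ← Real.rpow_mul_natCast (abs_nonneg _),
      Nat.cast_ofNat, div_mul_cancel₀ r two_ne_zero]
  have hchange := lintegral_pi_gaussianReal_le_of_linear (κ := Fin k × Fin (ℓ + 1))
    (fun c => (S.Psi ℓ x * S.W (c.1 + 1)) c.2) (S.residual ℓ x f θ k) hδ0 hδ1 hv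
    (hCS.le_varTrue hv) (hCS.varTrue_le hv)
    (G := fun y => ENNReal.ofReal (|S.propagationStat ℓ x k y| ^ (r / 2))) (by fun_prop)
    fun y y' h => by rw [propagationStat_eq_of_Psi_mul_W_eq hK hk1 hdet h]
  simp only [hsq, Fintype.card_prod, Fintype.card_fin] at hchange
  rw [lintegral_propagationStat_trueLaw hK hk1 hdet hProd f θ
    (F := fun t => ENNReal.ofReal (|t| ^ (r / 2))) (by fun_prop)]
  exact hchange.trans (add_le_add_left (hPC k hk2 hkK) _)

end Propagation

section RiskDecomposition

variable {k : ℕ} {f : ℝ → ℝ} {κ r zz : ℝ}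

lemma HasInformation.abs_apply_zero_le (h : S.HasInformation ℓ x k κ) (hκ : 0 < κ)
    {d : Fin (ℓ + 1) → ℝ} {t : ℝ} (hd : d ⬝ᵥ (S.B ℓ x k *ᵥ d) ≤ t) :
    |d 0| ≤ 1 / √κ * √t := by
  rw [one_div_mul_eq_div, ← Real.sqrt_div' _ hκ.le]
  exact Real.abs_le_sqrt ((le_div_iff₀' hκ).2 ((h d).trans hd))

lemma HasInformation.abs_lastAccepted_sub_fhat_le (h : S.HasInformation ℓ x k κ) (hκ : 0 < κ)
    (hk : k ∈ Finset.Icc 1 S.K) (hdet : IsUnit (S.B ℓ x k).det) (hz : k < S.K → S.z k ≤ zz)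
    (y : Fin n → ℝ) : |S.lastAccepted ℓ x k y 0 - S.fhat ℓ x y| ≤ 1 / √κ * √zz := by
  rw [Finset.mem_Icc] at hk
  obtain ⟨_, hkhatK, haccept⟩ := khat_mem (ℓ := ℓ) (x := x) (hk.1.trans hk.2) y
  obtain hle | hlt := le_or_gt (S.khat ℓ x y) k
  · rw [lastAccepted, min_eq_right hle, fhat, sub_self, abs_zero]
    positivity
  · have hT := (haccept k _ hk.1 hlt le_rfl).trans (hz (hlt.trans_le hkhatK))
    rw [T_eq_dotProduct hdet] at hT
    rw [lastAccepted, min_eq_left hlt.le, fhat]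
    exact h.abs_apply_zero_le hκ hT

lemma HasInformation.abs_sub_fhat_rpow_le (h : S.HasInformation ℓ x k κ) (hκ : 0 < κ)
    (hk : k ∈ Finset.Icc 1 S.K) (hdet : IsUnit (S.B ℓ x k).det) (hz : k < S.K → S.z k ≤ zz)
    (hr : 0 ≤ r) (y : Fin n → ℝ) :
    |f x - S.fhat ℓ x y| ^ r ≤ 3 ^ r * (|S.qmle ℓ x k y 0 - f x| ^ r
      + (1 / √κ) ^ r * |S.propagationStat ℓ x k y| ^ (r / 2) + (1 / √κ) ^ r * √zz ^ r) := by
  have hstat : |S.qmle ℓ x k y 0 - S.lastAccepted ℓ x k y 0|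
      ≤ 1 / √κ * √|S.propagationStat ℓ x k y| :=
    h.abs_apply_zero_le hκ (d := S.qmle ℓ x k y - S.lastAccepted ℓ x k y) (le_abs_self _)
  have hsplit : |f x - S.fhat ℓ x y| ≤ |S.qmle ℓ x k y 0 - f x|
      + 1 / √κ * √|S.propagationStat ℓ x k y| + 1 / √κ * √zz := by
    have hfhat := h.abs_lastAccepted_sub_fhat_le hκ hk hdet hz y
    have htri := abs_sub_le (f x) (S.qmle ℓ x k y 0) (S.fhat ℓ x y)
    have htri' := abs_sub_le (S.qmle ℓ x k y 0) (S.lastAccepted ℓ x k y 0) (S.fhat ℓ x y)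
    rw [abs_sub_comm (f x) (S.qmle ℓ x k y 0)] at htri
    linarith
  have hsqrt : √|S.propagationStat ℓ x k y| ^ r = |S.propagationStat ℓ x k y| ^ (r / 2) := by
    rw [Real.sqrt_eq_rpow, ← Real.rpow_mul (abs_nonneg _), one_div_mul_eq_div]
  calc |f x - S.fhat ℓ x y| ^ r ≤ (|S.qmle ℓ x k y 0 - f x|
      + 1 / √κ * √|S.propagationStat ℓ x k y| + 1 / √κ * √zz) ^ r := by gcongr
    _ ≤ 3 ^ r * (|S.qmle ℓ x k y 0 - f x| ^ r
      + (1 / √κ * √|S.propagationStat ℓ x k y|) ^ r + (1 / √κ * √zz) ^ r) :=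
        add_add_rpow_le (by positivity) (by positivity) (by positivity) hr
    _ = _ := by
        rw [Real.mul_rpow (by positivity) (by positivity), hsqrt,
          Real.mul_rpow (by positivity) (by positivity)]

lemma HasInformation.risk_le (h : S.HasInformation ℓ x k κ) (hκ : 0 < κ)
    (hk : k ∈ Finset.Icc 1 S.K) (hdet : IsUnit (S.B ℓ x k).det) (hz : k < S.K → S.z k ≤ zz)
    (hr : 0 ≤ r) {CD CB : ℝ} (hCD0 : 0 ≤ CD) (hCB0 : 0 ≤ CB)
    (hD : ∫⁻ y, ENNReal.ofReal (|S.qmle ℓ x k y 0 - f x| ^ r) ∂S.trueLaw f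
      ≤ ENNReal.ofReal (CD * (1 / √κ) ^ r))
    (hB : ∫⁻ y, ENNReal.ofReal (|S.propagationStat ℓ x k y| ^ (r / 2)) ∂S.trueLaw f
      ≤ ENNReal.ofReal CB) :
    ∫⁻ y, ENNReal.ofReal (|f x - S.fhat ℓ x y| ^ r) ∂S.trueLaw f
      ≤ ENNReal.ofReal (3 ^ r * (1 / √κ) ^ r * (CD + CB + √zz ^ r)) := by
  have hstat := measurable_propagationStat (ℓ := ℓ) (x := x)
    ((Finset.mem_Icc.1 hk).1.trans (Finset.mem_Icc.1 hk).2) k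
  calc ∫⁻ y, ENNReal.ofReal (|f x - S.fhat ℓ x y| ^ r) ∂S.trueLaw f
      ≤ ∫⁻ y, ENNReal.ofReal (3 ^ r) * (ENNReal.ofReal (|S.qmle ℓ x k y 0 - f x| ^ r)
          + ENNReal.ofReal ((1 / √κ) ^ r)
            * ENNReal.ofReal (|S.propagationStat ℓ x k y| ^ (r / 2))
          + ENNReal.ofReal ((1 / √κ) ^ r * √zz ^ r)) ∂S.trueLaw f := by
        refine lintegral_mono fun y => ?_
        rw [← ENNReal.ofReal_mul (by positivity), ← ENNReal.ofReal_add (by positivity)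
          (by positivity), ← ENNReal.ofReal_add (by positivity) (by positivity),
          ← ENNReal.ofReal_mul (by positivity)]
        exact ENNReal.ofReal_le_ofReal (h.abs_sub_fhat_rpow_le hκ hk hdet hz hr y)
    _ = ENNReal.ofReal (3 ^ r) * (∫⁻ y, ENNReal.ofReal (|S.qmle ℓ x k y 0 - f x| ^ r) ∂S.trueLaw f
          + ENNReal.ofReal ((1 / √κ) ^ r)
            * ∫⁻ y, ENNReal.ofReal (|S.propagationStat ℓ x k y| ^ (r / 2)) ∂S.trueLaw f
          + ENNReal.ofReal ((1 / √κ) ^ r * √zz ^ r)) := by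
        rw [lintegral_const_mul _ (by fun_prop), lintegral_add_right _ measurable_const,
          lintegral_add_left (by fun_prop), lintegral_const_mul _ (by fun_prop), lintegral_const,
          measure_univ, mul_one]
    _ ≤ ENNReal.ofReal (3 ^ r) * (ENNReal.ofReal (CD * (1 / √κ) ^ r)
          + ENNReal.ofReal ((1 / √κ) ^ r) * ENNReal.ofReal CB
          + ENNReal.ofReal ((1 / √κ) ^ r * √zz ^ r)) := by gcongr
    _ = ENNReal.ofReal (3 ^ r * (1 / √κ) ^ r * (CD + CB + √zz ^ r)) := by
        rw [← ENNReal.ofReal_mul (by positivity), ← ENNReal.ofReal_add (by positivity)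
          (by positivity), ← ENNReal.ofReal_add (by positivity) (by positivity),
          ← ENNReal.ofReal_mul (by positivity)]
        ring_nf

end RiskDecomposition

end Scheme

section ReferenceConstants

lemma one_div_sqrt_pow_le {δ a t : ℝ} (hδ0 : 0 ≤ δ) (hδ : δ ≤ 1 / 2) {N : ℕ} (hN : N ≤ a * t)
    (ha : 0 ≤ a) (hδt : δ * t ≤ 1) : (1 / √(1 - δ ^ 2)) ^ N ≤ Real.exp (2 * a) := by
  have hpos : 0 < 1 - δ ^ 2 := by nlinarith
  have hbase : 1 / √(1 - δ ^ 2) ≤ Real.exp (2 * δ) := by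
    rw [div_le_iff₀ (Real.sqrt_pos.2 hpos)]
    calc 1 ≤ (2 * δ + 1) * (1 - δ ^ 2) := by nlinarith [mul_nonneg hδ0 hδ0]
      _ ≤ Real.exp (2 * δ) * √(1 - δ ^ 2) := by
        gcongr
        · exact Real.add_one_le_exp _
        · exact Real.le_sqrt_of_sq_le (by nlinarith)
  calc (1 / √(1 - δ ^ 2)) ^ N ≤ Real.exp (2 * δ) ^ N := by gcongr
    _ = Real.exp (N * (2 * δ)) := (Real.exp_nat_mul _ _).symm
    _ ≤ Real.exp (2 * a) := by
        refine Real.exp_le_exp.2 ?_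
        calc (N : ℝ) * (2 * δ) ≤ a * t * (2 * δ) := by gcongr
          _ = 2 * a * (δ * t) := by ring
          _ ≤ 2 * a := mul_le_of_le_one_right (by positivity) hδt

lemma exists_theoreticalCrit_le {p : ℕ} {r α μ u a : ℝ} (hr : 0 < r) (hα : 0 < α) (hμ : 0 < μ)
    (hu : 1 ≤ u) (ha : 0 ≤ a) : ∃ A, 0 < A ∧ ∀ (K k : ℕ) (t : ℝ), 1 ≤ t → (K : ℝ) ≤ a * t →
      theoreticalCrit p r α μ u K k ≤ A * t := by
  obtain ⟨c, hc⟩ : ∃ c, c = -(p / 4 * Real.log (1 - 4 * μ)) - Real.log (1 - u ^ (-r))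
    + Real.log (2 ^ (2 * r) * √(Real.Gamma (2 * r + p / 2) * Real.Gamma (p / 2))
        / Real.Gamma (r + p / 2)) := ⟨_, rfl⟩
  have hlogu : 0 ≤ Real.log u := Real.log_nonneg hu
  refine ⟨4 / μ * ((r * Real.log u + 1 / α) * a + |c| + 1), by positivity, fun K k t ht hK => ?_⟩
  have hlogK : Real.log (K / α) ≤ 1 / α * (a * t) :=
    calc Real.log (K / α) ≤ 1 / α * K :=
          (Real.log_le_self (by positivity)).trans_eq (by ring)
      _ ≤ 1 / α * (a * t) := by gcongr
  have hlinear : r * ((K : ℝ) - k) * Real.log u ≤ r * (a * t) * Real.log u := by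
    gcongr
    linarith [k.cast_nonneg (α := ℝ)]
  have hconst : c ≤ |c| * t := (le_abs_self c).trans (le_mul_of_one_le_right (abs_nonneg c) ht)
  rw [theoreticalCrit, mul_assoc (4 / μ) _ t]
  gcongr
  linarith

/-- The part of the risk bound at a scale with modeling bias at most `Δ`, in units of the standard
deviation, which does not depend on the critical values. The two summands bound the error of the
estimator at this scale and the propagation statistic, if there are at most `a log n` scales. -/
noncomputable def referenceConst (p : ℕ) (r α Cw a Δ : ℝ) : ℝ :=
  affineGaussianMoment (√Δ + Cw * √2) (√2) r
    + (|α * chiSqMoment p r| + Real.exp (2 * Δ) * Real.exp (2 * (a * p)))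

end ReferenceConstants

section HolderRate

/-- The rate `L^{1/(2β+1)} N^{-β/(2β+1)}` of the pointwise risk over a Hölder class if the
smoothness is known; adaptation costs a further factor `√(log N)`. -/
noncomputable def holderRate (β L N : ℝ) : ℝ :=
  L ^ (1 / (2 * β + 1)) * N ^ (-(β / (2 * β + 1)))

variable {β L N : ℝ}

lemma holderRate_pos (hL : 0 < L) (hN : 0 < N) : 0 < holderRate β L N := by
  unfold holderRate
  positivity

lemma rpow_mul_logRate_rpow {r t : ℝ} (hβ : 0 < β) (hL : 0 ≤ L) (hN : 0 ≤ N) (ht : 0 ≤ t) :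
    L ^ (r / (2 * β + 1)) * (t ^ ((2 * β + 1) / (2 * β)) / N) ^ (r * β / (2 * β + 1))
      = holderRate β L N ^ r * √t ^ r := by
  rw [holderRate, Real.mul_rpow (by positivity) (by positivity),
    Real.div_rpow (by positivity) hN, ← Real.rpow_mul hL, ← Real.rpow_mul hN,
    ← Real.rpow_mul ht, Real.sqrt_eq_rpow, ← Real.rpow_mul ht, div_eq_mul_inv (t ^ _),
    ← Real.rpow_neg hN]
  have ht_exp : (2 * β + 1) / (2 * β) * (r * β / (2 * β + 1)) = 1 / 2 * r := by field_simp
  have hL_exp : 1 / (2 * β + 1) * r = r / (2 * β + 1) := by ring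
  have hN_exp : -(β / (2 * β + 1)) * r = -(r * β / (2 * β + 1)) := by ring
  rw [ht_exp, hL_exp, hN_exp]
  ring

lemma mul_holderRate_sq {h : ℝ} (hβ : 0 < β) (hL : 0 ≤ L) (hN : 0 < N) (hh : 0 ≤ h) :
    N * h * holderRate β L N ^ 2 = (N * h ^ (2 * β + 1) * L ^ 2) ^ (1 / (2 * β + 1)) := by
  have hN_exp : N * (N ^ (-(β / (2 * β + 1)))) ^ 2 = N ^ (1 / (2 * β + 1)) := by
    have hexp : 1 + -(β / (2 * β + 1)) * (2 : ℕ) = 1 / (2 * β + 1) := by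
      push_cast
      field_simp
      ring
    rw [← Real.rpow_mul_natCast hN.le, ← Real.rpow_one_add' hN.le (by rw [hexp]; positivity), hexp]
  rw [Real.mul_rpow (by positivity) (by positivity), Real.mul_rpow hN.le (by positivity),
    ← Real.rpow_mul hh, mul_one_div_cancel (by positivity), Real.rpow_one,
    ← Real.rpow_pow_comm hL, ← hN_exp, holderRate]
  ring

lemma one_div_sqrt_le_mul_holderRate {M h c : ℝ} (hβ : 0 < β) (hL : 0 ≤ L) (hN : 0 < N)
    (hh : 0 < h) (hM : 0 < M) (hc : 0 < c) (hle : M ≤ N * h ^ (2 * β + 1) * L ^ 2) :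
    1 / √(N * h / c) ≤ √(c / M ^ (1 / (2 * β + 1))) * holderRate β L N := by
  have hρ : 0 ≤ holderRate β L N := by unfold holderRate; positivity
  have hkey : M ^ (1 / (2 * β + 1)) ≤ N * h * holderRate β L N ^ 2 := by
    rw [mul_holderRate_sq hβ hL hN hh.le]
    gcongr
  rw [one_div, ← Real.sqrt_inv, Real.sqrt_le_left (by positivity), mul_pow,
    Real.sq_sqrt (by positivity), inv_div, div_mul_eq_mul_div,
    div_le_div_iff₀ (by positivity) (by positivity), mul_assoc]
  gcongr
  linarith

lemma rpow_mul_sq_le_of_bandwidth {cH h : ℝ} (hβ : 0 ≤ β) (hN : 0 < N) (hcH : 0 ≤ cH)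
    (hh : cH * N ^ (-(1 / (2 * β + 1))) ≤ h) :
    cH ^ (2 * β + 1) * L ^ 2 ≤ N * h ^ (2 * β + 1) * L ^ 2 := by
  gcongr
  calc cH ^ (2 * β + 1) = N * (cH * N ^ (-(1 / (2 * β + 1)))) ^ (2 * β + 1) := by
        rw [Real.mul_rpow hcH (by positivity), ← Real.rpow_mul hN.le, neg_mul,
          one_div_mul_cancel (by positivity), Real.rpow_neg_one]
        field_simp
    _ ≤ N * h ^ (2 * β + 1) := by gcongr

end HolderRate

lemma exists_pos_sqrt_div_rpow_mul_lt {q r b c C : ℝ} (hq : 0 < q) (hr : 0 < r) (hC : 0 < C) :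
    ∃ M, 0 < M ∧ √(c / M ^ q) ^ r * b < C := by
  have hquot : Tendsto (fun M : ℝ => √(c / M ^ q) ^ r) atTop (𝓝 0) := by
    simpa [Real.zero_rpow hr.ne'] using
      ((tendsto_const_nhds (x := c)).div_atTop (tendsto_rpow_atTop hq)).sqrt.rpow_const
        (.inr hr.le)
  have hlim : Tendsto (fun M : ℝ => √(c / M ^ q) ^ r * b) atTop (𝓝 0) := by
    simpa using hquot.mul_const b
  exact ((eventually_gt_atTop 0).and (hlim.eventually_lt_const hC)).exists

lemma eventually_mul_add_le {ι : Type*} {l : Filter ι} {g : ι → ℝ} (hg : Tendsto g l atTop)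
    {a C : ℝ} (D : ℝ) (ha : a < C) : ∀ᶠ i in l, a * g i + D ≤ C * g i := by
  filter_upwards [hg.eventually_ge_atTop (D / (C - a))] with i hi
  rw [div_le_iff₀ (sub_pos.2 ha)] at hi
  linarith

namespace Scheme

variable {n : ℕ} {S : Scheme n} {ℓ : ℕ} {x : ℝ}

section RiskAtReferenceScale

variable (S ℓ x) in
/-- The conditions on the scheme, at a single sample size, which enter the risk bound. -/
structure Admissible (r α u₀ u vmin vmax lam₀ a₀ δ : ℝ) : Prop where
  size_pos : 0 < n
  vmin_pos : 0 < vmin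
  vmax_pos : 0 < vmax
  lam₀_pos : 0 < lam₀
  basic : S.CondBasic
  condB : S.CondB ℓ x u₀ u
  condPC : S.CondPC ℓ x r α
  condS : S.CondS δ
  condS1 : S.CondS1 vmin vmax
  condLp1 : S.CondLp1 ℓ x lam₀ vmax
  condLp2 : S.CondLp2 a₀
  condLp3 : S.CondLp3 x
  condProd : S.CondProd

variable {r α u₀ u vmin vmax lam₀ a₀ δ κ Δ Cw a t zz : ℝ} {f : ℝ → ℝ} {k : ℕ}
  {θ : Fin (ℓ + 1) → ℝ}

namespace Admissible

lemma varModel_pos (hS : S.Admissible ℓ x r α u₀ u vmin vmax lam₀ a₀ δ) (i : Fin n) :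
    0 < S.varModel i :=
  NNReal.coe_pos.1 (hS.vmin_pos.trans_le (hS.condS1 i).1)

lemma isUnit_det (hS : S.Admissible ℓ x r α u₀ u vmin vmax lam₀ a₀ δ)
    (hk : k ∈ Finset.Icc 1 S.K) : IsUnit (S.B ℓ x k).det :=
  hS.condLp1.isUnit_det hS.size_pos hS.lam₀_pos hS.vmax_pos hk (hS.basic.h_pos hS.size_pos hk)

lemma w_mul_self (hS : S.Admissible ℓ x r α u₀ u vmin vmax lam₀ a₀ δ)
    (hk : k ∈ Finset.Icc 1 S.K) (i : Fin n) : S.w k i * S.w k i = S.w k i :=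
  hS.condProd k k (Finset.mem_Icc.1 hk).1 le_rfl (Finset.mem_Icc.1 hk).2 i

lemma sqrt_sum_smoother_sq_mul_varTrue_le
    (hS : S.Admissible ℓ x r α u₀ u vmin vmax lam₀ a₀ δ) (hδ : δ ≤ 1)
    (hk : k ∈ Finset.Icc 1 S.K) (hκ : 0 < κ) (hinfo : S.HasInformation ℓ x k κ) :
    √(∑ i, S.smoother ℓ x k i ^ 2 * S.varTrue i) ≤ √2 * (1 / √κ) :=
  hinfo.sqrt_sum_smoother_sq_mul_varTrue_le hκ (hS.isUnit_det hk) (hS.w_mul_self hk)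
    hS.varModel_pos hS.condS hδ

lemma abs_bias_le (hS : S.Admissible ℓ x r α u₀ u vmin vmax lam₀ a₀ δ) (hδ : δ ≤ 1)
    (hk : k ∈ Finset.Icc 1 S.K) (hκ : 0 < κ) (hinfo : S.HasInformation ℓ x k κ)
    (hCw : 0 ≤ Cw) (hfirst : S.FirstAccepted ℓ x f Cw) (hθ : θ 0 = f x)
    (hΔ : k = 1 ∨ S.modelingBias ℓ x f θ k ≤ Δ) :
    |S.bias ℓ x f k| ≤ (√Δ + Cw * √2) * (1 / √κ) := by
  rw [add_mul]
  obtain rfl | hΔ := hΔ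
  · refine le_add_of_nonneg_of_le (by positivity) (hfirst.abs_bias_one_le.trans ?_)
    rw [mul_assoc, stdDev_eq_sqrt_sum]
    gcongr
    exact hS.sqrt_sum_smoother_sq_mul_varTrue_le hδ hk hκ hinfo
  · exact le_add_of_le_of_nonneg (hinfo.abs_bias_le hκ (hS.isUnit_det hk) (hS.w_mul_self hk)
      hS.varModel_pos hθ hΔ) (by positivity)

lemma lintegral_abs_qmle_sub_rpow_le (hS : S.Admissible ℓ x r α u₀ u vmin vmax lam₀ a₀ δ)
    (hδ : δ ≤ 1) (hk : k ∈ Finset.Icc 1 S.K) (hκ : 0 < κ) (hinfo : S.HasInformation ℓ x k κ)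
    (hr : 0 < r) {c : ℝ} (hc : 0 ≤ c) (hbias : |S.bias ℓ x f k| ≤ c * (1 / √κ)) :
    ∫⁻ y, ENNReal.ofReal (|S.qmle ℓ x k y 0 - f x| ^ r) ∂S.trueLaw f
      ≤ ENNReal.ofReal (affineGaussianMoment c (√2) r * (1 / √κ) ^ r) := by
  rw [(hasLaw_qmle_sub S ℓ x f k).lintegral_comp (f := fun z => ENNReal.ofReal (|z| ^ r))
    (by measurability)]
  refine lintegral_abs_rpow_gaussianReal_le hr hc (by positivity) (by positivity) hbias ?_
  rw [Real.coe_toNNReal _ (by positivity)]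
  exact hS.sqrt_sum_smoother_sq_mul_varTrue_le hδ hk hκ hinfo

lemma lintegral_propagationStat_rpow_le
    (hS : S.Admissible ℓ x r α u₀ u vmin vmax lam₀ a₀ δ) (hδ : δ ≤ 1 / 2) (hδt : δ * t ≤ 1)
    (ha : 0 ≤ a) (hK : (S.K : ℝ) ≤ a * t) (hr : 0 < r) (hk : k ∈ Finset.Icc 1 S.K) (hΔ0 : 0 ≤ Δ)
    (hΔ : k = 1 ∨ S.modelingBias ℓ x f θ k ≤ Δ) :
    ∫⁻ y, ENNReal.ofReal (|S.propagationStat ℓ x k y| ^ (r / 2)) ∂S.trueLaw f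
      ≤ ENNReal.ofReal (|α * chiSqMoment (ℓ + 1) r|
        + Real.exp (2 * Δ) * Real.exp (2 * (a * (ℓ + 1 : ℕ)))) := by
  obtain rfl | hk1 := eq_or_ne k 1
  · simp [propagationStat_one hS.basic.1, Real.zero_rpow (half_pos hr).ne']
  have hmb := hΔ.resolve_left hk1
  obtain ⟨hk_pos, hkK⟩ := Finset.mem_Icc.1 hk
  have hδ0 := hS.condS.nonneg hS.size_pos
  refine (Scheme.lintegral_propagationStat_rpow_le hS.basic.1
    (Finset.mem_Icc.2 ⟨by omega, hkK⟩)
    (fun l hl => hS.isUnit_det (Finset.Icc_subset_Icc_right hkK hl)) hS.condProd hS.varModel_pos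
    hS.condPC hS.condS hδ0 (by linarith) f θ).trans ?_
  rw [ENNReal.ofReal_add (abs_nonneg _) (by positivity)]
  gcongr
  · exact le_abs_self _
  · rw [div_le_iff₀ (by linarith)]
    nlinarith
  · refine one_div_sqrt_pow_le hδ0 hδ (t := t) ?_ (by positivity) hδt
    calc ((k * (ℓ + 1) : ℕ) : ℝ) = k * (ℓ + 1 : ℕ) := Nat.cast_mul _ _
      _ ≤ a * t * (ℓ + 1 : ℕ) := by gcongr; exact (Nat.cast_le.2 hkK).trans hK
      _ = a * (ℓ + 1 : ℕ) * t := by ring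

lemma risk_le (hS : S.Admissible ℓ x r α u₀ u vmin vmax lam₀ a₀ δ) (hδ : δ ≤ 1 / 2)
    (hδt : δ * t ≤ 1) (ha : 0 ≤ a) (hK : (S.K : ℝ) ≤ a * t) (hr : 0 < r)
    (hk : k ∈ Finset.Icc 1 S.K) (hκ : 0 < κ) (hinfo : S.HasInformation ℓ x k κ) (hCw : 0 ≤ Cw)
    (hfirst : S.FirstAccepted ℓ x f Cw) (hθ : θ 0 = f x) (hΔ0 : 0 ≤ Δ)
    (hΔ : k = 1 ∨ S.modelingBias ℓ x f θ k ≤ Δ) (hz : k < S.K → S.z k ≤ zz) :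
    ∫⁻ y, ENNReal.ofReal (|f x - S.fhat ℓ x y| ^ r) ∂S.trueLaw f
      ≤ ENNReal.ofReal
          (3 ^ r * (1 / √κ) ^ r * (referenceConst (ℓ + 1) r α Cw a Δ + √zz ^ r)) := by
  have hδ1 : δ ≤ 1 := by linarith
  exact hinfo.risk_le hκ hk (hS.isUnit_det hk) hz hr.le (affineGaussianMoment_nonneg _ _ _)
    (by positivity)
    (hS.lintegral_abs_qmle_sub_rpow_le hδ1 hk hκ hinfo hr (by positivity)
      (hS.abs_bias_le hδ1 hk hκ hinfo hCw hfirst hθ hΔ))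
    (hS.lintegral_propagationStat_rpow_le hδ hδt ha hK hr hk hΔ0 hΔ)

end Admissible

end RiskAtReferenceScale

end Scheme

section ScaleSelection

lemma exists_mem_Icc_last {p : ℕ → Prop} {K : ℕ} (hK : 1 ≤ K) :
    ∃ k ∈ Finset.Icc 1 K, (k = 1 ∨ p k) ∧ (k < K → ¬p (k + 1)) := by
  classical
  refine ⟨Nat.findGreatest (fun k => k = 1 ∨ p k) K, Finset.mem_Icc.2
    ⟨Nat.le_findGreatest hK (.inl rfl), Nat.findGreatest_le K⟩,
    Nat.findGreatest_spec (P := fun k => k = 1 ∨ p k) hK (.inl rfl), fun hlt hp => ?_⟩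
  exact Nat.findGreatest_is_greatest (Nat.lt_succ_self _) hlt (.inr hp)

namespace Scheme

variable {n : ℕ} {S : Scheme n} {ℓ : ℕ} {x r α u₀ u vmin vmax lam₀ a₀ δ β L cH M : ℝ}

/-- The reference scale is the last one at which the squared bias `L² h^{2β}` is at most `M` times
the variance `1 / (n h)`: the next scale, or the largest bandwidth, bounds its variance. -/
lemma Admissible.exists_reference_scale (hS : S.Admissible ℓ x r α u₀ u vmin vmax lam₀ a₀ δ)
    (hu : 0 < u) (hβ : 0 < β) (hL : 0 < L) (hcH : 0 < cH) (hM : 0 < M)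
    (hbandwidth : cH * (n : ℝ) ^ (-(1 / (2 * β + 1))) ≤ S.h S.K) :
    ∃ k ∈ Finset.Icc 1 S.K, (k = 1 ∨ n * S.h k ^ (2 * β + 1) * L ^ 2 ≤ M) ∧
      ∃ κ, 0 < κ ∧ S.HasInformation ℓ x k κ ∧
        (1 / √κ ≤ √(vmax * u / lam₀ / M ^ (1 / (2 * β + 1))) * holderRate β L n ∨
          k = S.K ∧ 1 / √κ ≤ √(vmax / lam₀ / (cH ^ (2 * β + 1) * L ^ 2) ^ (1 / (2 * β + 1)))
            * holderRate β L n) := by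
  have hn : (0 : ℝ) < n := Nat.cast_pos.2 hS.size_pos
  have hvmax := hS.vmax_pos
  have hlam := hS.lam₀_pos
  have hinfo : ∀ k ∈ Finset.Icc 1 S.K, S.HasInformation ℓ x k (n * S.h k * lam₀ / vmax) :=
    fun k hk => hS.condLp1.hasInformation hlam.le hvmax.le hk (hS.basic.h_pos hS.size_pos hk).le
  obtain ⟨k, hk, hbal, hlast⟩ := exists_mem_Icc_last
    (p := fun k => n * S.h k ^ (2 * β + 1) * L ^ 2 ≤ M) hS.basic.1
  refine ⟨k, hk, hbal, ?_⟩
  obtain ⟨hk1, hkK⟩ := Finset.mem_Icc.1 hk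
  obtain hlt | rfl := hkK.lt_or_eq
  · have hnext : k + 1 ∈ Finset.Icc 1 S.K := Finset.mem_Icc.2 ⟨by omega, hlt⟩
    have hh := hS.basic.h_pos hS.size_pos hnext
    have hκ : n * S.h (k + 1) * lam₀ / vmax / u = n * S.h (k + 1) / (vmax * u / lam₀) := by
      field_simp
    refine ⟨n * S.h (k + 1) / (vmax * u / lam₀), by positivity,
      hκ ▸ hS.condB.hasInformation_div hu hk1 hlt (hinfo _ hnext), .inl ?_⟩
    exact one_div_sqrt_le_mul_holderRate hβ hL.le hn hh hM (by positivity) (not_le.1 (hlast hlt)).le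
  · have hh := hS.basic.h_pos hS.size_pos hk
    have hκ : n * S.h S.K * lam₀ / vmax = n * S.h S.K / (vmax / lam₀) := by field_simp
    refine ⟨n * S.h S.K / (vmax / lam₀), by positivity, hκ ▸ hinfo _ hk, .inr ⟨rfl, ?_⟩⟩
    exact one_div_sqrt_le_mul_holderRate hβ hL.le hn hh (by positivity) (by positivity)
      (rpow_mul_sq_le_of_bandwidth hβ.le hn hcH.le hbandwidth)

end Scheme

end ScaleSelection

namespace Scheme

section RiskAtOneSampleSize

variable {n : ℕ} {S : Scheme n} {ℓ : ℕ}
  {x r α u₀ u vmin vmax lam₀ a₀ δ β L cH M Cw a t A R : ℝ} {f : ℝ → ℝ}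

lemma Admissible.natCast_K_le (hS : S.Admissible ℓ x r α u₀ u vmin vmax lam₀ a₀ δ)
    (hu₀ : 1 < u₀) (hlog : 1 ≤ Real.log n)
    (hlogc : Real.log (2 * vmax / (lam₀ * vmin)) ≤ Real.log n) :
    (S.K : ℝ) ≤ (1 + 2 / Real.log u₀) * Real.log n := by
  have hvmin := hS.vmin_pos
  have hvmax := hS.vmax_pos
  have hlam := hS.lam₀_pos
  exact natCast_le_mul_log_of_pow_le hS.basic.1 hu₀
    (hS.condB.pow_le hS.basic hS.condS1 hS.condLp1 hS.size_pos hvmin hvmax hlam (by linarith))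
    (by positivity) (Nat.cast_pos.2 hS.size_pos) hlog hlogc

lemma Admissible.risk_le_mul_holderRate_rpow
    (hS : S.Admissible ℓ x r α u₀ u vmin vmax lam₀ a₀ δ) (hδ : δ ≤ 1 / 2) (hδt : δ * t ≤ 1)
    (ha : 0 ≤ a) (hK : (S.K : ℝ) ≤ a * t) (hr : 0 < r) (hu : 0 < u) (hℓβ : ℓ < β) (hL : 0 < L)
    (hx : x ∈ Set.Icc (0 : ℝ) 1) (ha₀ : 0 ≤ a₀) (hCw : 0 ≤ Cw) (hcH : 0 < cH) (hM : 0 < M)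
    (hbandwidth : cH * (n : ℝ) ^ (-(1 / (2 * β + 1))) ≤ S.h S.K)
    (hcrit : ∀ k, 1 ≤ k → k < S.K → S.z k ≤ A * t)
    (hR : 3 ^ r * √(vmax * u / lam₀ / M ^ (1 / (2 * β + 1))) ^ r
      * (referenceConst (ℓ + 1) r α Cw a (2 * a₀ / vmin * M) + √(A * t) ^ r) ≤ R)
    (hR' : 3 ^ r * √(vmax / lam₀ / (cH ^ (2 * β + 1) * L ^ 2) ^ (1 / (2 * β + 1))) ^ r
      * referenceConst (ℓ + 1) r α Cw a (2 * a₀ / vmin * M) ≤ R)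
    (hf : f ∈ HolderClass ℓ β L) (hfirst : S.FirstAccepted ℓ x f Cw) :
    ∫⁻ y, ENNReal.ofReal (|f x - S.fhat ℓ x y| ^ r) ∂S.trueLaw f
      ≤ ENNReal.ofReal (R * holderRate β L n ^ r) := by
  have hβ : 0 < β := ℓ.cast_nonneg.trans_lt hℓβ
  have hvmin := hS.vmin_pos
  have hρ := holderRate_pos (β := β) hL (Nat.cast_pos.2 hS.size_pos)
  obtain ⟨θ, hθ, htaylor⟩ := HolderClass.exists_taylor hℓβ.le hL.le hf hx
  obtain ⟨k, hk, hbal, κ, hκ, hinfo, hrate⟩ :=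
    hS.exists_reference_scale hu hβ hL hcH hM hbandwidth
  have hΔ : k = 1 ∨ S.modelingBias ℓ x f θ k ≤ 2 * a₀ / vmin * M := hbal.imp_right fun hle =>
    (modelingBias_le hS.basic hS.condLp2 hS.condLp3 hS.size_pos hvmin (fun i => (hS.condS1 i).1)
      ha₀ hβ.le hL.le hx hk fun i => by
        simpa [Matrix.mulVec, dotProduct, Psi] using htaylor _ (hS.basic.2.1 i)).trans (by gcongr)
  have hrisk := fun zz => hS.risk_le (zz := zz) hδ hδt ha hK hr hk hκ hinfo hCw hfirst hθ
    (by positivity) hΔ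
  have hconst : 0 ≤ referenceConst (ℓ + 1) r α Cw a (2 * a₀ / vmin * M) :=
    add_nonneg (affineGaussianMoment_nonneg _ _ _) (by positivity)
  have hscale : ∀ {Q : ℝ}, 0 ≤ Q → 1 / √κ ≤ Q * holderRate β L n → ∀ {b : ℝ}, 0 ≤ b →
      3 ^ r * Q ^ r * b ≤ R → 3 ^ r * (1 / √κ) ^ r * b ≤ R * holderRate β L n ^ r := by
    intro Q hQ hle b hb hbR
    calc 3 ^ r * (1 / √κ) ^ r * b ≤ 3 ^ r * (Q * holderRate β L n) ^ r * b := by gcongr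
      _ = 3 ^ r * Q ^ r * b * holderRate β L n ^ r := by rw [Real.mul_rpow hQ hρ.le]; ring
      _ ≤ R * holderRate β L n ^ r := by gcongr
  obtain hrate | ⟨rfl, hrate⟩ := hrate
  · exact (hrisk (A * t) (hcrit k (Finset.mem_Icc.1 hk).1)).trans <| ENNReal.ofReal_le_ofReal <|
      hscale (by positivity) hrate (by positivity) hR
  · refine (hrisk 0 fun hlt => (hlt.false).elim).trans <| ENNReal.ofReal_le_ofReal <|
      hscale (by positivity) hrate (by positivity) ?_
    rwa [Real.sqrt_zero, Real.zero_rpow hr.ne', add_zero]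

end RiskAtOneSampleSize

end Scheme

lemma tendsto_log_natCast_atTop : Tendsto (fun n : ℕ => Real.log n) atTop atTop :=
  Real.tendsto_log_atTop.comp tendsto_natCast_atTop_atTop

lemma eventually_mul_log_le_of_isLittleO {δ : ℕ → ℝ} (hδ : δ =o[atTop] fun n : ℕ => 1 / Real.log n)
    {c : ℝ} (hc : 0 < c) : ∀ᶠ n in atTop, δ n * Real.log n ≤ c := by
  filter_upwards [hδ.bound hc, tendsto_log_natCast_atTop.eventually_gt_atTop 0] with n hn hlog
  rw [Real.norm_eq_abs, Real.norm_of_nonneg (by positivity), mul_one_div, le_div_iff₀ hlog] at hn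
  exact (mul_le_mul_of_nonneg_right (le_abs_self _) hlog.le).trans hn

end LocPoly

theorem mainTheorem8_general
    (ℓ : ℕ) (β r vmin vmax lam₀ a₀ L x α μ u₀ u Cw cH C : ℝ) (δ : ℕ → ℝ)
    (S : (n : ℕ) → LocPoly.Scheme n) (hβ : (ℓ : ℝ) < β) (hr : 0 < r) (hvmin : 0 < vmin)
    (hvmax : vmin ≤ vmax) (hlam₀ : 0 < lam₀) (ha₀ : 0 < a₀) (hL : 0 < L)
    (hx : x ∈ Set.Icc (0 : ℝ) 1) (hα : 0 < α) (hμ : μ ∈ Set.Ioo (0 : ℝ) (1 / 4)) (hu₀ : 1 < u₀)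
    (hu : u₀ ≤ u) (hCw : 0 < Cw) (hcH : 0 < cH) (hC : 0 < C)
    (hδ : δ =o[atTop] fun n : ℕ => 1 / Real.log n)
    (hBasic : ∀ᶠ n in atTop, (S n).CondBasic)
    (hBandwidth : ∀ᶠ n : ℕ in atTop, cH * (n : ℝ) ^ (-(1 / (2 * β + 1))) ≤ (S n).h (S n).K)
    (hB : ∀ᶠ n in atTop, (S n).CondB ℓ x u₀ u)
    (hPC : ∀ᶠ n in atTop, (S n).CondPC ℓ x r α)
    (hCrit : ∀ᶠ n in atTop, (S n).CondCrit ℓ r α μ u)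
    (hS : ∀ᶠ n in atTop, (S n).CondS (δ n))
    (hS1 : ∀ᶠ n in atTop, (S n).CondS1 vmin vmax)
    (hLp1 : ∀ᶠ n in atTop, (S n).CondLp1 ℓ x lam₀ vmax)
    (hLp2 : ∀ᶠ n in atTop, (S n).CondLp2 a₀)
    (hLp3 : ∀ᶠ n in atTop, (S n).CondLp3 x)
    (hProd : ∀ᶠ n in atTop, (S n).CondProd) :
    ∀ᶠ n in atTop, ∀ f ∈ LocPoly.HolderClass ℓ β L, (S n).FirstAccepted ℓ x f Cw →
      ∫⁻ y, ENNReal.ofReal (|f x - (S n).fhat ℓ x y| ^ r) ∂(S n).trueLaw f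
        ≤ ENNReal.ofReal (C * L ^ (r / (2 * β + 1)) *
            (Real.log n ^ ((2 * β + 1) / (2 * β)) / n) ^ (r * β / (2 * β + 1))) := by
  have hβ0 : 0 < β := ℓ.cast_nonneg.trans_lt hβ
  have hu1 : 1 < u := hu₀.trans_le hu
  have ha : 0 ≤ 1 + 2 / Real.log u₀ := by have := Real.log_pos hu₀; positivity
  obtain ⟨A, hA, hAcrit⟩ := LocPoly.exists_theoreticalCrit_le (p := ℓ + 1) hr hα hμ.1 hu1.le ha
  obtain ⟨M, hM, hMC⟩ := LocPoly.exists_pos_sqrt_div_rpow_mul_lt (q := 1 / (2 * β + 1))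
    (b := 3 ^ r * √A ^ r) (c := vmax * u / lam₀) (by positivity) hr hC
  have hlog := LocPoly.tendsto_log_natCast_atTop
  have hsqrt : Tendsto (fun n : ℕ => √(Real.log n) ^ r) atTop atTop :=
    (tendsto_rpow_atTop hr).comp (Real.tendsto_sqrt_atTop.comp hlog)
  have hadm : ∀ᶠ n in atTop, (S n).Admissible ℓ x r α u₀ u vmin vmax lam₀ a₀ (δ n) := by
    filter_upwards [eventually_gt_atTop 0, hBasic, hB, hPC, hS, hS1, hLp1, hLp2, hLp3, hProd]
      with n hn hBasic hB hPC hS hS1 hLp1 hLp2 hLp3 hProd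
    exact ⟨hn, hvmin, hvmin.trans_le hvmax, hlam₀, hBasic, hB, hPC, hS, hS1, hLp1, hLp2, hLp3,
      hProd⟩
  obtain ⟨D, hD⟩ : ∃ D, D = LocPoly.referenceConst (ℓ + 1) r α Cw (1 + 2 / Real.log u₀)
    (2 * a₀ / vmin * M) := ⟨_, rfl⟩
  filter_upwards [hadm, hBandwidth, hCrit, hlog.eventually_ge_atTop 1,
    hlog.eventually_ge_atTop (Real.log (2 * vmax / (lam₀ * vmin))),
    LocPoly.eventually_mul_log_le_of_isLittleO hδ one_half_pos,
    LocPoly.eventually_mul_add_le hsqrt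
      (3 ^ r * √(vmax * u / lam₀ / M ^ (1 / (2 * β + 1))) ^ r * D) hMC,
    LocPoly.eventually_mul_add_le hsqrt (3 ^ r * √(vmax / lam₀
      / (cH ^ (2 * β + 1) * L ^ 2) ^ (1 / (2 * β + 1))) ^ r * D) hC]
    with n hadm hBandwidth hCrit hlog1 hlogc hδlog hR hR' f hf hfirst
  have hK := hadm.natCast_K_le hu₀ hlog1 hlogc
  have hδ_half : δ n ≤ 1 / 2 :=
    (le_mul_of_one_le_right (hadm.condS.nonneg hadm.size_pos) hlog1).trans hδlog
  refine (hadm.risk_le_mul_holderRate_rpow (A := A) (M := M) hδ_half (by linarith) ha hK hr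
    (by linarith) hβ hL hx ha₀.le hCw.le hcH hM hBandwidth
    (fun k hk hkK => (hCrit k hk hkK).trans (hAcrit _ _ _ hlog1 hK)) (R := C * √(Real.log n) ^ r)
    ?_ ?_ hf hfirst).trans_eq ?_
  · rw [← hD, Real.sqrt_mul hA.le, Real.mul_rpow (by positivity) (by positivity)]
    linarith
  · rw [← hD]
    linarith
  · rw [mul_assoc C (L ^ _), LocPoly.rpow_mul_logRate_rpow hβ0 hL.le n.cast_nonneg (by linarith)]
    ring_nf

theorem mainTheorem8
    (ℓ : ℕ) (β r vmin vmax wmax lam₀ a₀ : ℝ)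
    (hβ : (ℓ : ℝ) < β ∧ β ≤ ℓ + 1) (hr : 0 < r)
    (hvmin : 0 < vmin) (hvmax : vmin ≤ vmax) (hlam₀ : 0 < lam₀) (ha₀ : 0 < a₀) :
    ∃ C : ℝ, 0 < C ∧
      ∀ (L x α μ u₀ u s₁ Cw cH : ℝ) (δ : ℕ → ℝ) (S : (n : ℕ) → LocPoly.Scheme n),
        0 < L → x ∈ Set.Ioo (0 : ℝ) 1 → α ∈ Set.Ioc (0 : ℝ) 1 → μ ∈ Set.Ioo (0 : ℝ) (1 / 4) →
        1 < u₀ → u₀ ≤ u → 0 < s₁ → 0 < Cw → 0 < cH →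
        (∀ n, δ n ∈ Set.Ico (0 : ℝ) 1) →
        (δ =o[atTop] fun n : ℕ => 1 / Real.log n) →
        (∀ᶠ n in atTop, (S n).CondBasic) →
        (∀ᶠ n : ℕ in atTop, cH * (n : ℝ) ^ (-(1 / (2 * β + 1))) ≤ (S n).h (S n).K) →
        (∀ᶠ n in atTop, (S n).CondB ℓ x u₀ u) →
        (∀ᶠ n in atTop, (S n).CondD ℓ x) →
        (∀ᶠ n in atTop, (S n).CondLoc ℓ) →
        (∀ᶠ n in atTop, (S n).CondPC ℓ x r α) →
        (∀ᶠ n in atTop, (S n).CondCrit ℓ r α μ u) →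
        (∀ᶠ n in atTop, (S n).CondS (δ n)) →
        (∀ᶠ n in atTop, (S n).CondS1 vmin vmax) →
        (∀ᶠ n in atTop, (S n).CondLp1 ℓ x lam₀ vmax) →
        (∀ᶠ n in atTop, (S n).CondLp2 a₀) →
        (∀ᶠ n in atTop, (S n).CondLp3 x) →
        (∀ᶠ n in atTop, (S n).CondLp4 wmax) →
        (∀ᶠ n in atTop, (S n).CondW) →
        (∀ᶠ n in atTop, (S n).CondProd) →
        ∃ e : ℕ → ℝ, Tendsto e atTop (𝓝 0) ∧
          ∀ᶠ n in atTop, ∀ f ∈ LocPoly.HolderClass ℓ β L,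
            (S n).FirstAccepted ℓ x f Cw →
            (S n).CondSk1 ℓ x s₁ ((S n).oracleIndex ℓ x f Cw) →
            ∫⁻ y, ENNReal.ofReal (|f x - (S n).fhat ℓ x y| ^ r) ∂(S n).trueLaw f
              ≤ ENNReal.ofReal (C * L ^ (r / (2 * β + 1)) *
                  (Real.log n ^ ((2 * β + 1) / (2 * β)) / n) ^ (r * β / (2 * β + 1)) *
                  (1 + e n)) := by
  refine ⟨1, one_pos, fun L x α μ u₀ u s₁ Cw cH δ S hL hx hα hμ hu₀ hu _ hCw hcH _ hδ hBasic
    hBandwidth hB _ _ hPC hCrit hS hS1 hLp1 hLp2 hLp3 _ _ hProd =>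
    ⟨fun _ => 0, tendsto_const_nhds, ?_⟩⟩
  filter_upwards [mainTheorem8_general ℓ β r vmin vmax lam₀ a₀ L x α μ u₀ u Cw cH 1 δ S hβ.1 hr
    hvmin hvmax hlam₀ ha₀ hL (Set.Ioo_subset_Icc_self hx) hα.1 hμ hu₀ hu hCw hcH one_pos hδ hBasic
    hBandwidth hB hPC hCrit hS hS1 hLp1 hLp2 hLp3 hProd] with n hrisk f hf hfirst _
  simpa using hrisk f hf hfirst
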